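/- Let $\Gamma=\mathrm{SL}_2(\mathbb Z)$, let $k\ge 2$ and $N\ge 1$ be integers, and let $\mathcal G\subseteq\Gamma$ be a congruence subgroup containing $\Gamma(N)$. *Cusps and vectors.* Let $\mathcal C(\mathcal G)=\mathcal G\backslash\mathbb P^1(\mathbb Q)$ be the set of cusps of $\mathcal G$. A cusp $\mathcal G\sigma\infty$ ($\sigma\in\Gamma$) is called regular if, for every $b\in\mathbb Z$ with $T^b\in\sigma^{-1}\mathcal G\sigma$ or $-T^b\in\sigma^{-1}\mathcal G\sigma$, one has $T^b\in\sigma^{-1}\mathcal G\sigma$, where $T=\begin{pmatrix}1&1\\0&1\end{pmatrix}$. Let $\Lambda_N$ be the set of row vectors of additive order $N$ in $(\mathbb Z/N\mathbb Z)^2$, on which $\Gamma$ acts from the right, and let $\Lambda_N^{\pm}=\Lambda_N/\{\pm1\}$. The map $\phi_N:\mathcal C(\Gamma(N))\to\Lambda_N^{\pm}$, $\Gamma(N)\tfrac{\alpha}{\beta}\mapsto[\overline{(\beta,-\alpha)}]$ (with $\gcd(\alpha,\beta)=1$), is a bijection satisfying $\phi_N(\gamma y)=\phi_N(y)\gamma^{-1}$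 for $\gamma\in\Gamma$. For $x\in\mathcal C(\mathcal G)$ let $\mathrm{or}(x)\subseteq\mathcal C(\Gamma(N))$ be the finite set of cusps of $\Gamma(N)$ lying over $x$ (a $\mathcal G$-orbit). Scalar multiplication of $(\mathbb Z/N\mathbb Z)^\times$ on $\Lambda_N$ commutes with $\Gamma$, and through $\phi_N$ it induces an action of $(\mathbb Z/N\mathbb Z)^\times$ on $\mathcal C(\mathcal G)$. *Choices.* Let $\mathcal A\subseteq\Lambda_N$ be a set of representatives for $\Lambda_N^{\pm}$; for $y\in\mathcal C(\Gamma(N))$ let $\bar\lambda_y\in\mathcal A$ be the representative of $\phi_N(y)$. For each $x\in\mathcal C(\mathcal G)$ choose a scaling matrix $\sigma_x\in\Gamma$ such that $\sigma_x\infty$ represents $x$, and put $\mathcal O_x=\bar\lambda_{x}\mathcal G$, where $\bar\lambda_x=\bar\lambda_{\Gamma(N)\sigma_x\infty}$. If $k$ is odd, assume moreover that $-\mathrm{Id}\notin\mathcal G$; that $\mathcal A$ is $\mathcal G$-admissible, i.e. every $\mathcal G$-orbit $\mathcal O\subseteq\Lambda_N$ with $\mathcal O\cap(-\mathcal O)=\emptyset$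 and $\mathcal O\cap\mathcal A\ne\emptyset$ satisfies $\mathcal O\subseteq\mathcal A$; and that the scaling matrices are compatible with $\mathcal A$, i.e. $\overline{(0,1)}\sigma_x^{-1}=\bar\lambda_x$ for each regular cusp $x$. Put $$\varepsilon_{\mathcal A}(\bar\delta)=\varepsilon_{\mathcal A,x}(\bar\delta)=\begin{cases}1,&\bar\delta^{-1}\mathcal O_x=\mathcal O_{\bar\delta^{-1}x},\\-1,&\text{otherwise.}\end{cases}$$ *Series.* Let $\epsilon_N=\tfrac12$ if $N\in\{1,2\}$ and $\epsilon_N=1$ if $N\ge3$. For $\tau$ in the upper half-plane, $\mathrm{Re}(k+2s)>2$, and a cusp $x$ of $\mathcal G$ (regular if $k$ is odd), put $$G_{k,x}(\tau;s)=\sum_{y\in\mathrm{or}(x)}\ \sum_{\substack{(c,d)\in\mathbb Z^2\setminus\{(0,0)\}\\(c,d)\equiv\bar\lambda_y\ (N)}}\frac{\mathrm{Im}(\tau)^s}{(c\tau+d)^k|c\tau+d|^{2s}},\qquad E_{k,x}(\tau;s)=\sum_{\gamma\in\mathcal G_{\sigma_x\infty}\backslash\mathcal G}\mathbf j(\sigma_x^{-1}\gamma,\tau)^{-k}\,\mathrm{Im}(\sigma_x^{-1}\gamma\tau)^s,$$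 where $\mathcal G_{\sigma_x\infty}$ is the stabilizer of $\sigma_x\infty$ in $\mathcal G$ and $\mathbf j\left(\begin{pmatrix}a&b\\c&d\end{pmatrix},\tau\right)=c\tau+d$. For $\mathrm{Re}(z)>1$ put $$\zeta_+^{(N)}(\delta,z)=\sum_{\substack{n\ge1\\n\equiv\delta\,(N)}}\frac1{n^{z}},\qquad \zeta_+^{(N)}(\mu;\delta,z)=\sum_{\substack{n\ge1\\n\equiv\delta\,(N)}}\frac{\mu(n)}{n^{z}},$$ where $\mu$ is the Möbius function. **Proposition.** For every $\tau$ and every cusp $x$ of $\mathcal G$ (regular if $k$ is odd), the functions $s\mapsto G_{k,x}(\tau;s)$ and $s\mapsto E_{k,x}(\tau;s)$ continue analytically to the half-plane $\mathrm{Re}(k+2s)>1$, and for every $s$ in this half-plane the continued functions satisfy $$G_{k,x}(\tau;s)=\epsilon_N^{-1}\sum_{\bar\delta\in(\mathbb Z/N\mathbb Z)^\times}\varepsilon_{\mathcal A}(\bar\delta)^k\,\zeta_+^{(N)}(\delta,k+2s)\,E_{k,\bar\delta^{-1}x}(\tau;s),$$ $$E_{k,x}(\tau;s)=\epsilon_N\sum_{\bar\delta\in(\mathbb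 Z/N\mathbb Z)^\times}\varepsilon_{\mathcal A}(\bar\delta)^k\,\zeta_+^{(N)}(\mu;\delta,k+2s)\,G_{k,\bar\delta^{-1}x}(\tau;s).$$ -/

import Mathlib

noncomputable section

namespace CongEis

open Matrix OnePoint UpperHalfPlane
open scoped MatrixGroups

/-! ### Cusps -/

/-- `SL(2, ℤ)` acts on `ℙ¹(ℚ) = ℚ ∪ {∞}` by Möbius transformations. -/
instance : MulAction SL(2, ℤ) (OnePoint ℚ) :=
  MulAction.compHom (OnePoint ℚ) (Matrix.SpecialLinearGroup.mapGL ℚ : SL(2, ℤ) →* GL (Fin 2) ℚ)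

lemma smul_point_def (γ : SL(2, ℤ)) (p : OnePoint ℚ) :
    γ • p = (Matrix.SpecialLinearGroup.mapGL ℚ γ : GL (Fin 2) ℚ) • p := rfl

/-- The set `𝒞(𝒢)` of cusps of `𝒢`: the `𝒢`-orbits in `ℙ¹(ℚ)`. -/
abbrev Cusp (𝒢 : Subgroup SL(2, ℤ)) : Type := MulAction.orbitRel.Quotient 𝒢 (OnePoint ℚ)

/-- The cusp of `𝒢` represented by a point of `ℙ¹(ℚ)`. -/
def Cusp.mk (𝒢 : Subgroup SL(2, ℤ)) (p : OnePoint ℚ) : Cusp 𝒢 := Quotient.mk'' p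

lemma Cusp.mk_smul {𝒢 : Subgroup SL(2, ℤ)} {γ : SL(2, ℤ)} (hγ : γ ∈ 𝒢) (p : OnePoint ℚ) :
    Cusp.mk 𝒢 (γ • p) = Cusp.mk 𝒢 p :=
  Quotient.sound' ⟨⟨γ, hγ⟩, rfl⟩

lemma exists_smul_infty (p : OnePoint ℚ) : ∃ g : SL(2, ℤ), g • (∞ : OnePoint ℚ) = p :=
  OnePoint.exists_mem_SL2 ℤ p

/-- The natural map `𝒞(Γ(N)) → 𝒞(𝒢)` for `Γ(N) ≤ 𝒢`. -/
def cuspMap {N : ℕ} {𝒢 : Subgroup SL(2, ℤ)} (h : CongruenceSubgroup.Gamma N ≤ 𝒢) :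
    Cusp (CongruenceSubgroup.Gamma N) → Cusp 𝒢 :=
  Quotient.lift (Cusp.mk 𝒢) (by
    rintro _ p ⟨⟨γ, hγ⟩, rfl⟩
    exact Cusp.mk_smul (h hγ) p)

/-- `or_{𝒢,N}(x)`: the `𝒢`-orbit in `𝒞(Γ(N))` formed by the cusps of `Γ(N)` that lie
over the cusp `x` of `𝒢`. -/
def cuspOrbit {N : ℕ} {𝒢 : Subgroup SL(2, ℤ)} (h : CongruenceSubgroup.Gamma N ≤ 𝒢)
    (x : Cusp 𝒢) : Set (Cusp (CongruenceSubgroup.Gamma N)) :=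
  {y | cuspMap h y = x}

/-- The cusp `x = 𝒢 σ∞` is regular if `σ⁻¹ 𝒢 σ` is regular at `∞`, that is, if every integer `b`
with `± [1, b; 0, 1] ∈ σ⁻¹ 𝒢 σ` satisfies `[1, b; 0, 1] ∈ σ⁻¹ 𝒢 σ`. -/
def IsRegularCusp {𝒢 : Subgroup SL(2, ℤ)} (x : Cusp 𝒢) : Prop :=
  ∀ σ : SL(2, ℤ), Cusp.mk 𝒢 (σ • (∞ : OnePoint ℚ)) = x →
    ((𝒢.map (MulAut.conj σ⁻¹).toMonoidHom).map
      (Matrix.SpecialLinearGroup.toGL : SL(2, ℤ) →* GL (Fin 2) ℤ)).IsRegularAtInfty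

/-! ### The lattice modulo `N` -/

/-- `Λ_N`: the elements of order `N` in `(ℤ/N)²`. -/
@[ext]
structure Lat (N : ℕ) where
  val : Fin 2 → ZMod N
  order_eq : addOrderOf val = N

instance (N : ℕ) [NeZero N] : Finite (Lat N) :=
  Finite.of_injective Lat.val (fun _ _ => Lat.ext)

instance (N : ℕ) : Neg (Lat N) := ⟨fun v => ⟨-v.val, by rw [addOrderOf_neg]; exact v.order_eq⟩⟩

lemma Lat.neg_val {N : ℕ} (v : Lat N) : (-v).val = -v.val := rfl

/-- Reduction of a matrix modulo `N`. -/
def redN (N : ℕ) (γ : SL(2, ℤ)) : Matrix (Fin 2) (Fin 2) (ZMod N) :=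
  (Int.castRingHom (ZMod N)).mapMatrix (γ : Matrix (Fin 2) (Fin 2) ℤ)

lemma redN_mul (N : ℕ) (γ γ' : SL(2, ℤ)) : redN N (γ * γ') = redN N γ * redN N γ' := by
  rw [redN, Matrix.SpecialLinearGroup.coe_mul, map_mul]; rfl

lemma redN_one (N : ℕ) : redN N 1 = 1 := by
  rw [redN, Matrix.SpecialLinearGroup.coe_one, map_one]

/-- The right action of `SL(2, ℤ)` on row vectors in `Λ_N`. -/
def Lat.act {N : ℕ} (v : Lat N) (γ : SL(2, ℤ)) : Lat N :=
  ⟨v.val ᵥ* redN N γ, by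
    have hinj : Function.Injective
        (Matrix.vecMulLinear (redN N γ) : (Fin 2 → ZMod N) →ₗ[ZMod N] _).toAddMonoidHom := by
      intro a b hab
      have hab' : a ᵥ* redN N γ = b ᵥ* redN N γ := hab
      have := congrArg (fun w => w ᵥ* redN N γ⁻¹) hab'
      simpa only [Matrix.vecMul_vecMul, ← redN_mul, mul_inv_cancel, redN_one,
        Matrix.vecMul_one] using this
    exact (addOrderOf_injective _ hinj v.val).trans v.order_eq⟩

lemma Lat.act_val {N : ℕ} (v : Lat N) (γ : SL(2, ℤ)) : (v.act γ).val = v.val ᵥ* redN N γ := rfl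

lemma Lat.act_mul {N : ℕ} (v : Lat N) (γ γ' : SL(2, ℤ)) :
    v.act (γ * γ') = (v.act γ).act γ' := by
  apply Lat.ext
  simp only [Lat.act_val, redN_mul, Matrix.vecMul_vecMul]

lemma Lat.neg_act {N : ℕ} (v : Lat N) (γ : SL(2, ℤ)) : (-v).act γ = -(v.act γ) :=
  Lat.ext (by rw [Lat.act_val, Lat.neg_val, Lat.neg_val, Lat.act_val, Matrix.neg_vecMul])

lemma Lat.act_of_mem {N : ℕ} (v : Lat N) {γ : SL(2, ℤ)} (hγ : γ ∈ CongruenceSubgroup.Gamma N) :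
    v.act γ = v := by
  apply Lat.ext
  have : redN N γ = 1 := congrArg Subtype.val (CongruenceSubgroup.Gamma_mem'.mp hγ)
  rw [Lat.act_val, this, Matrix.vecMul_one]

/-- Scalar multiplication by `(ℤ/N)ˣ` on `Λ_N`. -/
def Lat.scale {N : ℕ} (δ : (ZMod N)ˣ) (v : Lat N) : Lat N :=
  ⟨δ • v.val, by
    have hinj : Function.Injective (DistribSMul.toAddMonoidHom (Fin 2 → ZMod N) δ) :=
      MulAction.injective δ
    exact (addOrderOf_injective _ hinj v.val).trans v.order_eq⟩

lemma Lat.scale_neg {N : ℕ} (δ : (ZMod N)ˣ) (v : Lat N) : (-v).scale δ = -(v.scale δ) :=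
  Lat.ext (smul_neg _ _)

lemma Lat.scale_act {N : ℕ} (δ : (ZMod N)ˣ) (v : Lat N) (γ : SL(2, ℤ)) :
    (v.act γ).scale δ = (v.scale δ).act γ :=
  Lat.ext (show δ • (v.val ᵥ* redN N γ) = (δ • v.val) ᵥ* redN N γ by rw [Matrix.smul_vecMul])

/-- The equivalence relation `μ = ± λ` on `Λ_N`. -/
def pmSetoid (N : ℕ) : Setoid (Lat N) where
  r v w := w = v ∨ w = -v
  iseqv :=
    { refl := fun _ => Or.inl rfl
      symm := by
        rintro v w (rfl | rfl)
        · exact Or.inl rfl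
        · exact Or.inr (Lat.ext (by simp [Lat.neg_val]))
      trans := by
        rintro u v w (rfl | rfl) (rfl | rfl)
        · exact Or.inl rfl
        · exact Or.inr rfl
        · exact Or.inr rfl
        · exact Or.inl (Lat.ext (by simp [Lat.neg_val])) }

/-- `Λ_N^± = Λ_N / {± Id}`. -/
def LatPM (N : ℕ) : Type := Quotient (pmSetoid N)

/-- The projection `Π_N : Λ_N → Λ_N^±`. -/
def LatPM.mk {N : ℕ} (v : Lat N) : LatPM N := Quotient.mk (pmSetoid N) v

lemma LatPM.mk_eq_iff {N : ℕ} {v w : Lat N} : LatPM.mk v = LatPM.mk w ↔ w = v ∨ w = -v :=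
  ⟨fun h => Quotient.exact h, fun h => Quotient.sound h⟩

instance (N : ℕ) [NeZero N] : Finite (LatPM N) := Quotient.finite _

/-- The action of `SL(2, ℤ)` on `Λ_N^±`. -/
def LatPM.act {N : ℕ} (θ : LatPM N) (γ : SL(2, ℤ)) : LatPM N :=
  Quotient.lift (fun v : Lat N => LatPM.mk (v.act γ)) (by
    rintro v w (rfl | rfl)
    · rfl
    · exact LatPM.mk_eq_iff.mpr (Or.inr (Lat.neg_act v γ))) θ

/-- The action of `(ℤ/N)ˣ` on `Λ_N^±`. -/
def LatPM.scale {N : ℕ} (δ : (ZMod N)ˣ) (θ : LatPM N) : LatPM N :=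
  Quotient.lift (fun v : Lat N => LatPM.mk (v.scale δ)) (by
    rintro v w (rfl | rfl)
    · rfl
    · exact LatPM.mk_eq_iff.mpr (Or.inr (Lat.scale_neg δ v))) θ

lemma LatPM.scale_act {N : ℕ} (δ : (ZMod N)ˣ) (θ : LatPM N) (γ : SL(2, ℤ)) :
    (θ.act γ).scale δ = (θ.scale δ).act γ := by
  induction θ using Quotient.inductionOn with
  | h v => exact congrArg LatPM.mk (Lat.scale_act δ v γ)

/-! ### The bijection `φ_N : 𝒞(Γ(N)) → Λ_N^±` -/

/-- For `p = α/β` in lowest terms the row vector `(β, -α)`; `∞ = 1/0`. -/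
def primVec : OnePoint ℚ → Fin 2 → ℤ :=
  fun p => p.elim ![0, -1] (fun q : ℚ => ![(q.den : ℤ), -q.num])

lemma isCoprime_primVec (p : OnePoint ℚ) : IsCoprime (primVec p 0) (primVec p 1) := by
  induction p using OnePoint.rec with
  | infty => exact ⟨0, -1, by simp [primVec]⟩
  | coe q =>
    have : IsCoprime (q.den : ℤ) (-q.num) := by
      rw [IsCoprime.neg_right_iff, isCoprime_comm, Int.isCoprime_iff_gcd_eq_one]
      exact q.reduced
    simpa [primVec] using this

lemma addOrderOf_of_isCoprime (N : ℕ) {v : Fin 2 → ℤ} (hv : IsCoprime (v 0) (v 1)) :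
    addOrderOf (fun i => (v i : ZMod N)) = N := by
  rw [← Nat.dvd_right_iff_eq]
  intro n
  rw [addOrderOf_dvd_iff_nsmul_eq_zero]
  constructor
  · intro h
    obtain ⟨a, b, hab⟩ := hv
    have h0 : ((n : ℤ) * v 0 : ZMod N) = 0 := by simpa using congrFun h 0
    have h1 : ((n : ℤ) * v 1 : ZMod N) = 0 := by simpa using congrFun h 1
    have : ((n : ℕ) : ZMod N) = 0 := by
      have e : ((n : ℤ) : ZMod N) = ((a * (n * v 0) + b * (n * v 1) : ℤ) : ZMod N) := by
        congr 1
        linear_combination -(n : ℤ) * hab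
      have e' : ((n : ℤ) : ZMod N) = 0 := by
        rw [e]
        push_cast at h0 h1 ⊢
        rw [h0, h1]
        simp
      exact_mod_cast e'
    exact (ZMod.natCast_eq_zero_iff n N).mp this
  · intro h
    have := (ZMod.natCast_eq_zero_iff n N).mpr h
    ext i
    simp [this]

/-- The reduction modulo `N` of a primitive vector. -/
def Lat.ofPrim (N : ℕ) (v : Fin 2 → ℤ) (hv : IsCoprime (v 0) (v 1)) : Lat N :=
  ⟨fun i => (v i : ZMod N), addOrderOf_of_isCoprime N hv⟩

/-- The class of `(0, 1)` in `Λ_N`. -/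
def Lat.base (N : ℕ) : Lat N := Lat.ofPrim N ![0, 1] ⟨0, 1, by simp⟩

/-- `φ_N` on points of `ℙ¹(ℚ)`: `α/β ↦ [(β, -α)]`. -/
def phiPoint (N : ℕ) (p : OnePoint ℚ) : LatPM N :=
  LatPM.mk (Lat.ofPrim N (primVec p) (isCoprime_primVec p))

lemma base_act_val (N : ℕ) (g : SL(2, ℤ)) :
    ((Lat.base N).act g).val = fun i => ((g 1 i : ℤ) : ZMod N) := by
  ext i
  simp [Lat.act_val, redN, Lat.base, Lat.ofPrim, Matrix.vecMul, dotProduct, Fin.sum_univ_two]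

lemma coprime_unique {a b c d : ℤ} (h₁ : IsCoprime a b) (h₂ : IsCoprime c d)
    (h : a * d = b * c) : (c = a ∧ d = b) ∨ (c = -a ∧ d = -b) := by
  have hac : a ∣ c := h₁.dvd_of_dvd_mul_left ⟨d, h.symm⟩
  have hca : c ∣ a := h₂.dvd_of_dvd_mul_right ⟨b, by linarith⟩
  obtain ⟨e, he⟩ := hac
  obtain ⟨f, hf⟩ := hca
  have hbd : b ∣ d := h₁.symm.dvd_of_dvd_mul_left ⟨c, h⟩
  have hdb : d ∣ b := h₂.symm.dvd_of_dvd_mul_right ⟨a, by linarith⟩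
  have h1 := Int.natAbs_eq_natAbs_iff.mp
    (Nat.dvd_antisymm (Int.natAbs_dvd_natAbs.mpr ⟨f, hf⟩) (Int.natAbs_dvd_natAbs.mpr ⟨e, he⟩))
  have h2 := Int.natAbs_eq_natAbs_iff.mp
    (Nat.dvd_antisymm (Int.natAbs_dvd_natAbs.mpr hdb) (Int.natAbs_dvd_natAbs.mpr hbd))
  rcases h1 with h1 | h1 <;> rcases h2 with h2 | h2
  · exact Or.inl ⟨h1, h2⟩
  · subst h1 h2
    have : c * b = 0 := by linarith
    rcases mul_eq_zero.mp this with h0 | h0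
    · exact Or.inr ⟨by omega, rfl⟩
    · exact Or.inl ⟨rfl, by omega⟩
  · subst h1 h2
    have : a * d = 0 := by linarith
    rcases mul_eq_zero.mp this with h0 | h0
    · exact Or.inl ⟨by omega, rfl⟩
    · exact Or.inr ⟨rfl, by omega⟩
  · exact Or.inr ⟨h1, h2⟩

lemma primVec_smul_infty (g : SL(2, ℤ)) :
    primVec (g • (∞ : OnePoint ℚ)) 0 * g 0 0 = primVec (g • (∞ : OnePoint ℚ)) 1 * -g 1 0 := by
  rw [smul_point_def, OnePoint.smul_infty_eq_ite]
  by_cases hc : g 1 0 = 0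
  · simp [hc, primVec]
  · have hc' : ((g 1 0 : ℤ) : ℚ) ≠ 0 := by exact_mod_cast hc
    have h := Rat.num_div_den (((g 0 0 : ℤ) : ℚ) / ((g 1 0 : ℤ) : ℚ))
    have hd : ((((g 0 0 : ℤ) : ℚ) / ((g 1 0 : ℤ) : ℚ)).den : ℚ) ≠ 0 := by
      exact_mod_cast Rat.den_nz _
    rw [div_eq_div_iff hd hc'] at h
    have h' : (((g 0 0 : ℤ) : ℚ) / ((g 1 0 : ℤ) : ℚ)).num * g 1 0 =
        g 0 0 * (((g 0 0 : ℤ) : ℚ) / ((g 1 0 : ℤ) : ℚ)).den := by exact_mod_cast h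
    simp [hc, primVec]
    linarith

lemma phiPoint_smul_infty (N : ℕ) (g : SL(2, ℤ)) :
    phiPoint N (g • (∞ : OnePoint ℚ)) = LatPM.mk ((Lat.base N).act g⁻¹) := by
  have hcop : IsCoprime (-g 1 0) (g 0 0) := by
    have hdet := g.det_coe
    rw [Matrix.det_fin_two] at hdet
    exact ⟨g 0 1, g 1 1, by linarith⟩
  have h0 : (g⁻¹ : SL(2, ℤ)) 1 0 = -g 1 0 := by
    rw [Matrix.SpecialLinearGroup.coe_inv, Matrix.adjugate_fin_two]; simp
  have h1 : (g⁻¹ : SL(2, ℤ)) 1 1 = g 0 0 := by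
    rw [Matrix.SpecialLinearGroup.coe_inv, Matrix.adjugate_fin_two]; simp
  apply LatPM.mk_eq_iff.mpr
  rcases coprime_unique (isCoprime_primVec (g • (∞ : OnePoint ℚ))) hcop (primVec_smul_infty g)
    with ⟨e0, e1⟩ | ⟨e0, e1⟩
  · left
    apply Lat.ext
    rw [base_act_val]
    ext i
    fin_cases i
    · simp only [Lat.ofPrim, Fin.zero_eta, h0, e0]
    · simp only [Lat.ofPrim, Fin.mk_one, h1, e1]
  · right
    apply Lat.ext
    rw [base_act_val, Lat.neg_val]
    ext i
    fin_cases i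
    · simp only [Lat.ofPrim, Fin.zero_eta, h0, e0, Pi.neg_apply, Int.cast_neg]
    · simp only [Lat.ofPrim, Fin.mk_one, h1, e1, Pi.neg_apply, Int.cast_neg]

lemma phiPoint_smul (N : ℕ) (γ : SL(2, ℤ)) (p : OnePoint ℚ) :
    phiPoint N (γ • p) = (phiPoint N p).act γ⁻¹ := by
  obtain ⟨g, rfl⟩ := exists_smul_infty p
  rw [← mul_smul, phiPoint_smul_infty, phiPoint_smul_infty, _root_.mul_inv_rev, Lat.act_mul]
  rfl

lemma LatPM.act_of_mem {N : ℕ} (θ : LatPM N) {γ : SL(2, ℤ)}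
    (hγ : γ ∈ CongruenceSubgroup.Gamma N) : θ.act γ = θ := by
  induction θ using Quotient.inductionOn with
  | h v => exact congrArg LatPM.mk (Lat.act_of_mem v hγ)

/-- `φ_N : 𝒞(Γ(N)) → Λ_N^±`, `α/β ↦ [(β, -α)]` for coprime `α`, `β`. -/
def phi (N : ℕ) : Cusp (CongruenceSubgroup.Gamma N) → LatPM N :=
  Quotient.lift (phiPoint N) (by
    rintro _ p ⟨⟨γ, hγ⟩, rfl⟩
    exact (phiPoint_smul N γ p).trans (LatPM.act_of_mem _ (inv_mem hγ)))

lemma T_zpow_smul_infty (b : ℤ) : (ModularGroup.T ^ b) • (∞ : OnePoint ℚ) = ∞ := by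
  rw [smul_point_def, OnePoint.smul_infty_eq_self_iff]
  rw [Matrix.SpecialLinearGroup.mapGL_coe_matrix, Matrix.SpecialLinearGroup.map_apply_coe,
    ModularGroup.coe_T_zpow]
  simp

lemma neg_smul_infty (g : SL(2, ℤ)) : (-g) • (∞ : OnePoint ℚ) = g • ∞ := by
  rw [smul_point_def, smul_point_def, OnePoint.smul_infty_eq_ite, OnePoint.smul_infty_eq_ite]
  simp

lemma mk_eq_of_base_act {N : ℕ} {g h : SL(2, ℤ)}
    (e : (Lat.base N).act g⁻¹ = (Lat.base N).act h⁻¹) :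
    Cusp.mk (CongruenceSubgroup.Gamma N) (g • (∞ : OnePoint ℚ)) =
      Cusp.mk (CongruenceSubgroup.Gamma N) (h • (∞ : OnePoint ℚ)) := by
  have e1 : (Lat.base N).act (g⁻¹ * h) = Lat.base N := by
    rw [Lat.act_mul, e, ← Lat.act_mul, inv_mul_cancel]
    exact Lat.act_of_mem _ (one_mem _)
  have e2 := congrArg Lat.val e1
  rw [base_act_val] at e2
  set m := g⁻¹ * h with hm
  have hm10 : ((m 1 0 : ℤ) : ZMod N) = 0 := by
    simpa [Lat.base, Lat.ofPrim] using congrFun e2 0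
  have hm11 : ((m 1 1 : ℤ) : ZMod N) = 1 := by
    simpa [Lat.base, Lat.ofPrim] using congrFun e2 1
  have hm00 : ((m 0 0 : ℤ) : ZMod N) = 1 := by
    have hdet := m.det_coe
    rw [Matrix.det_fin_two] at hdet
    have := congrArg (Int.cast : ℤ → ZMod N) hdet
    push_cast at this
    rw [hm10, hm11] at this
    simpa using this
  have hmem : m * ModularGroup.T ^ (-m 0 1) ∈ CongruenceSubgroup.Gamma N := by
    rw [CongruenceSubgroup.Gamma_mem]
    simp only [Matrix.SpecialLinearGroup.coe_mul, ModularGroup.coe_T_zpow, Matrix.mul_apply,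
      Fin.sum_univ_two]
    simp [hm10, hm11, hm00]
  have hmem' := (CongruenceSubgroup.Gamma_normal N).conj_mem _ hmem g
  rw [← Cusp.mk_smul hmem', ← mul_smul, inv_mul_cancel_right, hm, ← mul_assoc,
    mul_inv_cancel_left, mul_smul, T_zpow_smul_infty]

lemma phi_injective (N : ℕ) : Function.Injective (phi N) := by
  intro x y
  induction x using Quotient.inductionOn with | h p
  induction y using Quotient.inductionOn with | h q
  obtain ⟨g, rfl⟩ := exists_smul_infty p
  obtain ⟨h, rfl⟩ := exists_smul_infty q
  intro e
  have e' : LatPM.mk ((Lat.base N).act g⁻¹) = LatPM.mk ((Lat.base N).act h⁻¹) := by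
    rw [← phiPoint_smul_infty, ← phiPoint_smul_infty]; exact e
  rcases LatPM.mk_eq_iff.mp e' with e' | e'
  · exact mk_eq_of_base_act e'.symm
  · have : (Lat.base N).act (-g)⁻¹ = (Lat.base N).act h⁻¹ := by
      rw [e']
      apply Lat.ext
      rw [base_act_val, Lat.neg_val, base_act_val]
      ext i
      simp
    have := mk_eq_of_base_act this
    rwa [neg_smul_infty] at this

/-- A pair with `gcd(a, b, N) = 1` and `a ≠ 0` becomes coprime after adding a multiple of `N`
to `b`. -/
lemma exists_coprime_lift (N : ℕ) (a b : ℤ) (ha : a ≠ 0)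
    (h : ∀ p : ℕ, p.Prime → (p : ℤ) ∣ a → (p : ℤ) ∣ b → ¬ p ∣ N) :
    ∃ t : ℤ, IsCoprime a (b + t * N) := by
  refine ⟨((∏ p ∈ a.natAbs.primeFactors.filter (fun p : ℕ => ¬ (p : ℤ) ∣ b), p : ℕ) : ℤ), ?_⟩
  rw [Int.isCoprime_iff_gcd_eq_one]
  by_contra hg
  obtain ⟨p, hp, hpg⟩ := Nat.exists_prime_and_dvd hg
  have hpa : (p : ℤ) ∣ a := (Int.natCast_dvd_natCast.mpr hpg).trans (Int.gcd_dvd_left _ _)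
  have hpb := (Int.natCast_dvd_natCast.mpr hpg).trans (Int.gcd_dvd_right a _)
  have hpf : p ∈ a.natAbs.primeFactors :=
    Nat.mem_primeFactors.mpr ⟨hp, Int.natCast_dvd.mp hpa, Int.natAbs_ne_zero.mpr ha⟩
  by_cases hb : (p : ℤ) ∣ b
  · have h1 := (Int.dvd_add_right hb).mp hpb
    rw [← Nat.cast_mul, Int.natCast_dvd_natCast] at h1
    rcases hp.dvd_mul.mp h1 with h2 | h2
    · obtain ⟨q, hq, hpq⟩ := (Prime.dvd_finsetProd_iff hp.prime _).mp h2
      rw [Finset.mem_filter] at hq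
      have : p = q := (Nat.prime_dvd_prime_iff_eq hp (Nat.prime_of_mem_primeFactors hq.1)).mp hpq
      exact hq.2 (this ▸ hb)
    · exact h p hp hpa hb h2
  · apply hb
    refine (Int.dvd_add_left ?_).mp hpb
    refine Dvd.dvd.mul_right (Int.natCast_dvd_natCast.mpr ?_) _
    exact Finset.dvd_prod_of_mem _ (Finset.mem_filter.mpr ⟨hpf, hb⟩)

lemma base_act_surjective (N : ℕ) [NeZero N] (v : Lat N) :
    ∃ g : SL(2, ℤ), (Lat.base N).act g = v := by
  obtain ⟨w, hw⟩ := v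
  have hN : (N : ℤ) ≠ 0 := by exact_mod_cast NeZero.ne N
  obtain ⟨a, ha, ha0⟩ : ∃ a : ℤ, (a : ZMod N) = w 0 ∧ a ≠ 0 := by
    obtain ⟨a, ha⟩ := ZMod.intCast_surjective (w 0)
    by_cases h : a = 0
    · exact ⟨N, by rw [← ha, h]; simp, hN⟩
    · exact ⟨a, ha, h⟩
  obtain ⟨b, hb⟩ := ZMod.intCast_surjective (w 1)
  obtain ⟨t, ht⟩ := exists_coprime_lift N a b ha0 (by
    intro p hp hpa hpb hpN
    obtain ⟨m, hm⟩ := hpN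
    obtain ⟨a', rfl⟩ := hpa
    obtain ⟨b', rfl⟩ := hpb
    have hz : ((m : ZMod N) * p) = 0 := by
      rw [mul_comm, ← Nat.cast_mul, ← hm, ZMod.natCast_self]
    have : m • w = 0 := by
      ext i
      fin_cases i
      · simp [← ha, ← mul_assoc, hz]
      · simp [← hb, ← mul_assoc, hz]
    have hd := addOrderOf_dvd_of_nsmul_eq_zero this
    rw [hw, hm] at hd
    have hm0 : m ≠ 0 := by
      rintro rfl
      exact NeZero.ne N (by simpa using hm)
    have := Nat.le_of_dvd (Nat.pos_of_ne_zero hm0) hd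
    nlinarith [hp.two_le, Nat.pos_of_ne_zero hm0])
  have hgcd : IsCoprime (![a, b + t * N] 0) (![a, b + t * N] 1) := by simpa using ht
  obtain ⟨g, hg⟩ := hgcd.exists_SL2_row 1
  refine ⟨g, Lat.ext ?_⟩
  rw [base_act_val]
  ext i
  fin_cases i
  · simpa [← ha] using congrArg (Int.cast : ℤ → ZMod N) hg.1
  · simpa [← hb] using congrArg (Int.cast : ℤ → ZMod N) hg.2

lemma phi_surjective (N : ℕ) [NeZero N] : Function.Surjective (phi N) := by
  intro θ
  induction θ using Quotient.inductionOn with | h v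
  obtain ⟨g, rfl⟩ := base_act_surjective N v
  refine ⟨Cusp.mk _ (g⁻¹ • ∞), ?_⟩
  exact (phiPoint_smul_infty N g⁻¹).trans (by rw [inv_inv]; rfl)

/-- The bijection `φ_N`. -/
def phiEquiv (N : ℕ) [NeZero N] : Cusp (CongruenceSubgroup.Gamma N) ≃ LatPM N :=
  Equiv.ofBijective (phi N) ⟨phi_injective N, phi_surjective N⟩

instance (N : ℕ) [NeZero N] : Finite (Cusp (CongruenceSubgroup.Gamma N)) :=
  Finite.of_equiv _ (phiEquiv N).symm

/-- The action of `(ℤ/N)ˣ` on `𝒞(𝒢)`: the cusp `x`, represented by `p ∈ ℙ¹(ℚ)`, is sent to the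
cusp of `𝒢` under the cusp `φ_N⁻¹(δ · φ_N(p))` of `Γ(N)`. -/
def unitAct {N : ℕ} [NeZero N] {𝒢 : Subgroup SL(2, ℤ)} (h : CongruenceSubgroup.Gamma N ≤ 𝒢)
    (δ : (ZMod N)ˣ) : Cusp 𝒢 → Cusp 𝒢 :=
  Quotient.lift (fun p => cuspMap h ((phiEquiv N).symm ((phiPoint N p).scale δ))) (by
    rintro _ p ⟨⟨γ, hγ⟩, rfl⟩
    show cuspMap h ((phiEquiv N).symm ((phiPoint N (γ • p)).scale δ)) = _
    obtain ⟨y, hy⟩ := (phiEquiv N).surjective ((phiPoint N p).scale δ)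
    induction y using Quotient.inductionOn with | h q
    have hq : phiPoint N q = (phiPoint N p).scale δ := hy
    have hq' : phiEquiv N (Cusp.mk _ (γ • q)) = (phiPoint N (γ • p)).scale δ := by
      rw [phiPoint_smul, LatPM.scale_act, ← hq]
      exact phiPoint_smul N γ q
    have hq'' : phiEquiv N (Cusp.mk _ q) = (phiPoint N p).scale δ := hq
    rw [← hq', ← hq'', Equiv.symm_apply_apply, Equiv.symm_apply_apply]
    exact Cusp.mk_smul hγ q)

/-! ### Orbits and choices of representatives -/

/-- The `𝒢`-orbit of `v` in `Λ_N`. -/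
def latOrbit {N : ℕ} (𝒢 : Subgroup SL(2, ℤ)) (v : Lat N) : Set (Lat N) :=
  {w | ∃ γ ∈ 𝒢, w = v.act γ}

/-- A `𝒢`-orbit `𝒪 ⊆ Λ_N` is regular if `𝒪 ∩ (-𝒪) = ∅`. -/
def IsRegularOrbit {N : ℕ} (𝒪 : Set (Lat N)) : Prop :=
  ∀ w ∈ 𝒪, -w ∉ 𝒪

/-- A set `𝒜` of representatives for the orbits of `{± Id}` on `Λ_N`. -/
structure SignReps (N : ℕ) where
  carrier : Set (Lat N)
  existsUnique : ∀ θ : LatPM N, ∃! v, v ∈ carrier ∧ LatPM.mk v = θ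

/-- `Π_{N,𝒜}⁻¹ : Λ_N^± → 𝒜`. -/
def SignReps.lift {N : ℕ} (A : SignReps N) (θ : LatPM N) : Lat N :=
  (A.existsUnique θ).choose

/-- `𝒜` is `𝒢`-admissible: a regular `𝒢`-orbit that meets `𝒜` is contained in `𝒜`. -/
def SignReps.IsAdmissible {N : ℕ} (A : SignReps N) (𝒢 : Subgroup SL(2, ℤ)) : Prop :=
  ∀ v : Lat N, IsRegularOrbit (latOrbit 𝒢 v) →
    (latOrbit 𝒢 v ∩ A.carrier).Nonempty → latOrbit 𝒢 v ⊆ A.carrier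

/-- A choice of a scaling matrix `σ_x` for every cusp `x` of `𝒢`; the point `σ_x ∞` is the chosen
representative of `x` in `ℙ¹(ℚ)`. -/
structure ScalingChoice (𝒢 : Subgroup SL(2, ℤ)) where
  mat : Cusp 𝒢 → SL(2, ℤ)
  mk_mat : ∀ x, Cusp.mk 𝒢 (mat x • (∞ : OnePoint ℚ)) = x

/-- The scaling matrices of the regular cusps are compatible with `𝒜`:
`Π_{N,𝒜}⁻¹(φ_N(σ_x ∞)) = (0, 1) σ_x⁻¹` for each regular cusp `x`. -/
def ScalingChoice.IsCompatible {N : ℕ} {𝒢 : Subgroup SL(2, ℤ)} (σ : ScalingChoice 𝒢)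
    (A : SignReps N) : Prop :=
  ∀ x : Cusp 𝒢, IsRegularCusp x →
    A.lift (phi N (Cusp.mk _ (σ.mat x • (∞ : OnePoint ℚ)))) = (Lat.base N).act (σ.mat x)⁻¹

/-- `𝒪_x = λ_x 𝒢` where `λ_x = Π_{N,𝒜}⁻¹(φ_N(σ_x ∞))`. -/
def orbitOfCusp {N : ℕ} {𝒢 : Subgroup SL(2, ℤ)} (A : SignReps N) (σ : ScalingChoice 𝒢)
    (x : Cusp 𝒢) : Set (Lat N) :=
  latOrbit 𝒢 (A.lift (phi N (Cusp.mk _ (σ.mat x • (∞ : OnePoint ℚ)))))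

open Classical in
/-- The sign `ε_𝒜(δ)` at the cusp `x`: it is `1` if `δ⁻¹ 𝒪_x = 𝒪_{δ⁻¹ x}` and `-1` otherwise. -/
def cuspSign {N : ℕ} [NeZero N] {𝒢 : Subgroup SL(2, ℤ)} (h : CongruenceSubgroup.Gamma N ≤ 𝒢)
    (A : SignReps N) (σ : ScalingChoice 𝒢) (x : Cusp 𝒢) (δ : (ZMod N)ˣ) : ℂ :=
  if Lat.scale δ⁻¹ '' orbitOfCusp A σ x = orbitOfCusp A σ (unitAct h δ⁻¹ x) then 1 else -1

/-! ### Eisenstein series -/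

/-- `ε_N`, equal to `1/2` for `N ∈ {1, 2}` and to `1` for `N ≥ 3`. -/
def epsN (N : ℕ) : ℂ := if N ≤ 2 then 1 / 2 else 1

/-- `Im(τ)^s / ((cτ + d)^k |cτ + d|^{2s})` for `v = (c, d)`. -/
def eisTerm (k : ℕ) (τ : ℍ) (s : ℂ) (v : Fin 2 → ℤ) : ℂ :=
  (τ.im : ℂ) ^ s /
    (((v 0 : ℂ) * τ + v 1) ^ k * ((‖(v 0 : ℂ) * τ + v 1‖ : ℝ) : ℂ) ^ (2 * s))

/-- `G_k(τ, λ, N; s)`: the sum over the nonzero `(c, d) ≡ λ` modulo `N`. -/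
def levelG (k : ℕ) {N : ℕ} (v : Lat N) (τ : ℍ) (s : ℂ) : ℂ :=
  ∑' w : {w : Fin 2 → ℤ // (fun i => (w i : ZMod N)) = v.val ∧ w ≠ 0}, eisTerm k τ s w.1

/-- The series defining `G_{k,x}(τ; s)` for `Re(k + 2s) > 2`. -/
def seriesG (k : ℕ) {N : ℕ} {𝒢 : Subgroup SL(2, ℤ)} (h : CongruenceSubgroup.Gamma N ≤ 𝒢)
    (A : SignReps N) (x : Cusp 𝒢) (τ : ℍ) (s : ℂ) : ℂ :=
  ∑ᶠ y ∈ cuspOrbit h x, levelG k (A.lift (phi N y)) τ s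

/-- The automorphy factor `j(γ, τ) = cτ + d`. -/
def autFactor (γ : SL(2, ℤ)) (τ : ℍ) : ℂ := (γ 1 0 : ℂ) * τ + γ 1 1

/-- The spectral series `∑ j(σ⁻¹γ, τ)^{-k} Im(σ⁻¹γτ)^s` over `γ ∈ 𝒢_p \ 𝒢`, where `p = σ∞`, for
`Re(k + 2s) > 2`. One representative is taken in each coset; when `k` is even, or `-Id ∉ 𝒢` and
the cusp is regular, the terms do not depend on it. -/
def seriesE (k : ℕ) (𝒢 : Subgroup SL(2, ℤ)) (σ : SL(2, ℤ)) (τ : ℍ) (s : ℂ) : ℂ :=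
  ∑' q : Quotient (QuotientGroup.rightRel (MulAction.stabilizer 𝒢 (σ • (∞ : OnePoint ℚ)))),
    (autFactor (σ⁻¹ * (q.out : SL(2, ℤ))) τ ^ k)⁻¹ *
      (((σ⁻¹ * (q.out : SL(2, ℤ))) • τ).im : ℂ) ^ s

/-- `F` is an analytic continuation of `f`, given on `Re(k + 2s) > 2`, to `Re(k + 2s) > 1`. -/
structure IsContinuation (k : ℕ) (f F : ℂ → ℂ) : Prop where
  analytic : AnalyticOnNhd ℂ F {s | 1 < ((k : ℂ) + 2 * s).re}
  eq : ∀ s : ℂ, 2 < ((k : ℂ) + 2 * s).re → F s = f s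

/-- The analytic continuation to `Re(k + 2s) > 1`, if there is one; its values in this half-plane
are then unique. -/
def continuation (k : ℕ) (f : ℂ → ℂ) : ℂ → ℂ := Classical.epsilon (IsContinuation k f)

/-- The unnormalized Eisenstein series `G_{k,x}(τ; s)` for `Re(k + 2s) > 1`. -/
def unnormG (k : ℕ) {N : ℕ} {𝒢 : Subgroup SL(2, ℤ)} (h : CongruenceSubgroup.Gamma N ≤ 𝒢)
    (A : SignReps N) (x : Cusp 𝒢) (τ : ℍ) : ℂ → ℂ :=
  continuation k (seriesG k h A x τ)

/-- The spectral Eisenstein series `E_{k,x}(τ; s)` for `Re(k + 2s) > 1`. -/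
def spectralE (k : ℕ) {𝒢 : Subgroup SL(2, ℤ)} (σ : ScalingChoice 𝒢) (x : Cusp 𝒢) (τ : ℍ) :
    ℂ → ℂ :=
  continuation k (seriesE k 𝒢 (σ.mat x) τ)

/-- `ζ₊^{(N)}(δ, z) = ∑_{n ≥ 1, n ≡ δ (N)} n^{-z}`. -/
def zetaPlus {N : ℕ} (δ : (ZMod N)ˣ) (z : ℂ) : ℂ :=
  ∑' n : {n : ℕ // 1 ≤ n ∧ (n : ZMod N) = δ}, 1 / ((n : ℕ) : ℂ) ^ z

/-- `ζ₊^{(N)}(μ; δ, z) = ∑_{n ≥ 1, n ≡ δ (N)} μ(n) n^{-z}`. -/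
def zetaPlusMu {N : ℕ} (δ : (ZMod N)ˣ) (z : ℂ) : ℂ :=
  ∑' n : {n : ℕ // 1 ≤ n ∧ (n : ZMod N) = δ},
    ((ArithmeticFunction.moebius (n : ℕ) : ℤ) : ℂ) / ((n : ℕ) : ℂ) ^ z

end CongEis

end

/-!
The terms of both series are values of the kernel `u⁻ᵏ |u|ᵏ⁻ᶻ`, `z = k + 2s`, at lattice points `u`.
Subtracting from each value the mean of the kernel over the unit segment from `u` to `u + 1` gains
one power of `|u|`, so that the sum of the differences converges for `Re z > 1`. The means over one
horizontal row of the lattice add up to the integral over the whole line, which scales with the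
height of the line, and the sum over the rows is this integral times a two-sided Hurwitz zeta
function. That zeta function has a pole at `z = 2` only if `k` is even, and then the integral
vanishes there. This continues `G` to `Re z > 1`.

In the region of absolute convergence, splitting off `n = gcd (c, d)` writes the sum over a class
`v` modulo `N` as the combination, over the classes `δ` of `n`, of the sums over the coprime vectors
in the classes `δ⁻¹ v`, with coefficients `ζ₊(δ, k + 2s)`. Möbius inversion in the group algebra of
`(ℤ/N)ˣ` inverts this relation. Each coset of the stabilizer of `σ∞` in `𝒢` corresponds to the two
coprime vectors `±(0, 1) σ⁻¹ γ`; both lie in the chosen class when `v = -v`, that is when `N ≤ 2`,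
and exactly one does otherwise, which is the factor `ε_N`. Both identities extend to `Re z > 1` by
the identity theorem.
-/

namespace CongEis

open Matrix OnePoint UpperHalfPlane
open scoped MatrixGroups Topology

/-! ### Holomorphic dependence on a parameter -/

section Parameter

open MeasureTheory Filter Metric

variable {α : Type*} [MeasurableSpace α] {μ : Measure α}

lemma aestronglyMeasurable_deriv_parameter {𝕜 E : Type*} [NontriviallyNormedField 𝕜]
    [NormedAddCommGroup E] [NormedSpace 𝕜 E] {F : 𝕜 → α → E} {s₀ : 𝕜}
    (hm : ∀ᶠ s in 𝓝 s₀, AEStronglyMeasurable (F s) μ)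
    (hd : ∀ t, DifferentiableAt 𝕜 (fun s => F s t) s₀) :
    AEStronglyMeasurable (fun t => deriv (fun s => F s t) s₀) μ := by
  obtain ⟨u, hu⟩ := exists_seq_tendsto (𝓝[≠] s₀)
  obtain ⟨n₀, hn₀⟩ := eventually_atTop.mp (hu.eventually (hm.filter_mono nhdsWithin_le_nhds))
  refine aestronglyMeasurable_of_tendsto_ae atTop
    (f := fun n t => slope (fun s => F s t) s₀ (u (n + n₀))) (fun n => ?_)
    (Eventually.of_forall fun t => ?_)
  · exact ((hn₀ _ (Nat.le_add_left _ _)).sub hm.self_of_nhds).const_smul _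
  · exact (hasDerivAt_iff_tendsto_slope.mp (hd t).hasDerivAt).comp
      ((tendsto_add_atTop_iff_nat n₀).mpr hu)

lemma differentiableAt_integral_of_dominated {E : Type*} [NormedAddCommGroup E]
    [NormedSpace ℂ E] {F : ℂ → α → E} {s₀ : ℂ} {V : Set ℂ} (hV : V ∈ 𝓝 s₀)
    (hd : ∀ t, DifferentiableOn ℂ (fun s => F s t) V)
    (hm : ∀ s ∈ V, AEStronglyMeasurable (F s) μ) {bound : α → ℝ} (hbound : Integrable bound μ)
    (hF : ∀ᵐ t ∂μ, ∀ s ∈ V, ‖F s t‖ ≤ bound t) :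
    DifferentiableAt ℂ (fun s => ∫ t, F s t ∂μ) s₀ := by
  obtain ⟨ε, hε, hball⟩ := Metric.mem_nhds_iff.mp hV
  have hdisc : ∀ s ∈ ball s₀ (ε / 2), ∀ w ∈ closedBall s (ε / 3), w ∈ ball s₀ ε := by
    intro s hs w hw
    rw [mem_ball, mem_closedBall] at *
    linarith [dist_triangle w s s₀]
  have hderiv : ∀ t, ∀ s ∈ ball s₀ (ε / 2),
      HasDerivAt (fun s => F s t) (deriv (fun s => F s t) s) s := fun t s hs =>
    ((hd t).differentiableAt (mem_of_superset
      (isOpen_ball.mem_nhds (ball_subset_ball (half_le_self hε.le) hs)) hball)).hasDerivAt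
  have hcauchy : ∀ᵐ t ∂μ, ∀ s ∈ ball s₀ (ε / 2),
      ‖deriv (fun s => F s t) s‖ ≤ bound t / (ε / 3) := by
    filter_upwards [hF] with t ht s hs
    refine Complex.norm_deriv_le_of_forall_mem_sphere_norm_le (by positivity)
      (((hd t).mono fun w hw => ?_).diffContOnCl) fun w hw => ?_
    · exact hball (hdisc s hs w (closure_ball_subset_closedBall hw))
    · exact ht w (hball (hdisc s hs w (sphere_subset_closedBall hw)))
  have hs₀ : s₀ ∈ ball s₀ (ε / 2) := mem_ball_self (half_pos hε)
  have hmV : ∀ᶠ s in 𝓝 s₀, AEStronglyMeasurable (F s) μ := mem_of_superset hV hm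
  have hint : Integrable (F s₀) μ :=
    hbound.mono' hmV.self_of_nhds (hF.mono fun t ht => ht _ (mem_of_mem_nhds hV))
  exact (hasDerivAt_integral_of_dominated_loc_of_deriv_le (ball_mem_nhds s₀ (half_pos hε)) hmV hint
    (aestronglyMeasurable_deriv_parameter hmV fun t => (hderiv t s₀ hs₀).differentiableAt)
    hcauchy (hbound.div_const _) (Eventually.of_forall hderiv)).2.differentiableAt

lemma isOpen_lt_re (a : ℝ) : IsOpen {z : ℂ | a < z.re} :=
  isOpen_lt continuous_const Complex.continuous_re

lemma rpow_neg_le_add {x r σ R : ℝ} (hx : 0 ≤ x) (hσ : 0 < σ) (hr : r ≤ σ) (hR : σ ≤ R) :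
    x ^ (-σ) ≤ x ^ (-r) + x ^ (-R) := by
  rcases hx.eq_or_lt with rfl | hx
  · rw [Real.zero_rpow (neg_ne_zero.mpr hσ.ne')]
    positivity
  rcases le_total 1 x with h | h
  · exact (Real.rpow_le_rpow_of_exponent_le h (neg_le_neg hr)).trans
      (le_add_of_nonneg_right (Real.rpow_nonneg hx.le _))
  · exact (Real.rpow_le_rpow_of_exponent_ge hx h (neg_le_neg hR)).trans
      (le_add_of_nonneg_left (Real.rpow_nonneg hx.le _))

lemma exists_nhds_mul_rpow_le {C : ℂ → ℝ} (hC : Continuous C) {a e : ℝ} (he : 0 ≤ a + e)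
    {z₀ : ℂ} (hz₀ : a < z₀.re) :
    ∃ V ⊆ {z : ℂ | a < z.re}, IsOpen V ∧ z₀ ∈ V ∧ ∃ M q Q : ℝ, a < q ∧ a < Q ∧
      ∀ z ∈ V, ∀ x ≥ 0, C z * x ^ (-(z.re + e)) ≤ M * (x ^ (-(q + e)) + x ^ (-(Q + e))) := by
  obtain ⟨q, haq, hq⟩ := exists_between hz₀
  obtain ⟨Q, hQ⟩ := exists_gt z₀.re
  refine ⟨{z | C z < |C z₀| + 1} ∩ ({z | q < z.re} ∩ {z | z.re < Q}), fun z hz => haq.trans hz.2.1,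
    (isOpen_lt hC continuous_const).inter ((isOpen_lt_re q).inter
      (isOpen_lt Complex.continuous_re continuous_const)),
    ⟨lt_add_of_le_of_pos (le_abs_self (C z₀)) one_pos, hq, hQ⟩, |C z₀| + 1, q, Q, haq,
    haq.trans (hq.trans hQ), fun z hz x hx => ?_⟩
  exact mul_le_mul hz.1.le (rpow_neg_le_add hx
    (by linarith [show q < z.re from hz.2.1]) (by linarith [show q < z.re from hz.2.1])
    (by linarith [show z.re < Q from hz.2.2])) (Real.rpow_nonneg hx _) (by positivity)

lemma differentiableOn_tsum_of_norm_le_rpow {ι : Type*} {F : ι → ℂ → ℂ} {C : ℂ → ℝ} {x : ι → ℝ}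
    {e a : ℝ} (hC : Continuous C) (he : 0 ≤ a + e) (hx : ∀ i, 0 ≤ x i)
    (hd : ∀ i, DifferentiableOn ℂ (F i) {z | a < z.re})
    (hF : ∀ z, a < z.re → ∀ i, ‖F i z‖ ≤ C z * x i ^ (-(z.re + e)))
    (hs : ∀ q > a, Summable fun i => x i ^ (-(q + e))) :
    DifferentiableOn ℂ (fun z => ∑' i, F i z) {z | a < z.re} := by
  intro z₀ hz₀
  obtain ⟨V, hVa, hV, hz₀V, M, q, Q, hq, hQ, hle⟩ := exists_nhds_mul_rpow_le hC he hz₀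
  exact ((Complex.differentiableOn_tsum_of_summable_norm (((hs q hq).add (hs Q hQ)).mul_left M)
    (fun i => (hd i).mono hVa) hV fun i z hz =>
      (hF z (hVa hz) i).trans (hle z hz _ (hx i))).differentiableAt
    (hV.mem_nhds hz₀V)).differentiableWithinAt

lemma differentiableOn_integral_of_norm_le_rpow {F : ℂ → α → ℂ} {C : ℂ → ℝ} {x : α → ℝ}
    {e a : ℝ} (hC : Continuous C) (he : 0 ≤ a + e) (hx : ∀ t, 0 ≤ x t)
    (hd : ∀ t, DifferentiableOn ℂ (fun z => F z t) {z | a < z.re})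
    (hm : ∀ z, a < z.re → AEStronglyMeasurable (F z) μ)
    (hF : ∀ z, a < z.re → ∀ t, ‖F z t‖ ≤ C z * x t ^ (-(z.re + e)))
    (hi : ∀ q > a, Integrable (fun t => x t ^ (-(q + e))) μ) :
    DifferentiableOn ℂ (fun z => ∫ t, F z t ∂μ) {z | a < z.re} := by
  intro z₀ hz₀
  obtain ⟨V, hVa, hV, hz₀V, M, q, Q, hq, hQ, hle⟩ := exists_nhds_mul_rpow_le hC he hz₀
  exact (differentiableAt_integral_of_dominated (hV.mem_nhds hz₀V) (fun t => (hd t).mono hVa)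
    (fun z hz => hm z (hVa hz)) (((hi q hq).add (hi Q hQ)).const_mul M)
    (Eventually.of_forall fun t z hz =>
      (hF z (hVa hz) t).trans (hle z hz _ (hx t)))).differentiableWithinAt

end Parameter

/-! ### Continuation of the lattice sum -/

section Kernel

/-- The function `u⁻ᵏ |u|ᵏ⁻ᶻ` of `u`, so that `z = k + 2s` gives the function `u⁻ᵏ |u|⁻²ˢ` summed
in an Eisenstein series. With the junk value of `0⁻¹` it vanishes at `u = 0` for `k ≠ 0`. -/
noncomputable def eisKernel (k : ℕ) (z u : ℂ) : ℂ := (‖u‖ / u) ^ k * (‖u‖ : ℂ) ^ (-z)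

lemma eisKernel_eq {k : ℕ} {z u : ℂ} (hu : u ≠ 0) :
    eisKernel k z u = (‖u‖ : ℂ) ^ (k - z) / u ^ k := by
  rw [eisKernel, sub_eq_add_neg, Complex.cpow_add _ _ (by simpa using hu), Complex.cpow_natCast,
    div_pow]
  ring

lemma eisKernel_zero {k : ℕ} (hk : k ≠ 0) (z : ℂ) : eisKernel k z 0 = 0 := by
  simp [eisKernel, hk]

lemma norm_eisKernel (k : ℕ) (z : ℂ) {u : ℂ} (hu : u ≠ 0) :
    ‖eisKernel k z u‖ = ‖u‖ ^ (-z.re) := by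
  rw [eisKernel, norm_mul, Complex.norm_cpow_eq_rpow_re_of_pos (norm_pos_iff.mpr hu)]
  simp [hu]

lemma eisKernel_ofReal_mul (k : ℕ) (z u : ℂ) {r : ℝ} (hr : 0 < r) :
    eisKernel k z (r * u) = (r : ℂ) ^ (-z) * eisKernel k z u := by
  have hr' : (r : ℂ) ≠ 0 := by exact_mod_cast hr.ne'
  rw [eisKernel, eisKernel, norm_mul, Complex.norm_of_nonneg hr.le, Complex.ofReal_mul,
    Complex.mul_cpow_ofReal_nonneg hr.le (norm_nonneg _), mul_div_mul_left _ _ hr']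
  ring

lemma eisKernel_neg (k : ℕ) (z u : ℂ) : eisKernel k z (-u) = (-1) ^ k * eisKernel k z u := by
  rw [eisKernel, eisKernel, norm_neg, div_neg, neg_pow, mul_assoc]

lemma differentiable_eisKernel {k : ℕ} {u : ℂ} (h : k ≠ 0 ∨ u ≠ 0) :
    Differentiable ℂ fun z => eisKernel k z u := by
  rcases eq_or_ne u 0 with rfl | hu
  · simp_rw [eisKernel_zero (h.resolve_right fun hu => hu rfl)]
    exact differentiable_const 0
  · exact fun _ =>
      (DifferentiableAt.const_cpow (by fun_prop) (Or.inl (by simpa using hu))).const_mul _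

lemma eisTerm_eq {k : ℕ} (hk : k ≠ 0) (τ : ℍ) (s : ℂ) (w : Fin 2 → ℤ) :
    eisTerm k τ s w = (τ.im : ℂ) ^ s * eisKernel k (k + 2 * s) ((w 0 : ℂ) * τ + w 1) := by
  rw [eisTerm]
  rcases eq_or_ne ((w 0 : ℂ) * τ + w 1) 0 with hw | hw
  · simp [hw, eisKernel_zero hk, hk]
  · rw [eisKernel_eq hw, sub_add_cancel_left, Complex.cpow_neg]
    field_simp

/-- The logarithmic derivative of `eisKernel k z` in the direction `1`. -/
noncomputable def eisKernelLogDeriv (k : ℕ) (z u : ℂ) : ℂ :=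
  (k - z) * (u.re / ‖u‖ ^ 2 : ℝ) - k / u

lemma hasDerivAt_eisKernel_add_ofReal (k : ℕ) (z : ℂ) {u : ℂ} {x : ℝ} (hu : u + x ≠ 0) :
    HasDerivAt (fun x : ℝ => eisKernel k z (u + x))
      (eisKernel k z (u + x) * eisKernelLogDeriv k z (u + x)) x := by
  have hlin : HasDerivAt (fun x : ℝ => u + (x : ℂ)) 1 x :=
    (Complex.ofRealCLM.hasDerivAt.const_add u).congr_deriv (by simp)
  have hsq : HasDerivAt (fun x : ℝ => ((‖u + x‖ ^ 2 : ℝ) : ℂ)) (2 * (u + x).re : ℝ) x :=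
    (hlin.norm_sq.congr_deriv (by simp [Complex.inner])).ofReal_comp
  have hpos : (0 : ℝ) < ‖u + x‖ ^ 2 := by positivity
  have hcpow : HasDerivAt (fun x : ℝ => ((‖u + x‖ ^ 2 : ℝ) : ℂ) ^ ((k - z) / 2))
      ((k - z) / 2 * ((‖u + x‖ ^ 2 : ℝ) : ℂ) ^ ((k - z) / 2 - 1) * (2 * (u + x).re : ℝ)) x :=
    ((hasDerivAt_id' _).cpow_const (Complex.ofReal_mem_slitPlane.mpr hpos)).comp_of_eq x hsq rfl
      |>.congr_deriv (by rw [mul_one])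
  have hquot := hcpow.fun_div (hlin.fun_pow k) (pow_ne_zero k hu)
  have hsqrt : ∀ w : ℂ, w ≠ 0 → eisKernel k z w = ((‖w‖ ^ 2 : ℝ) : ℂ) ^ ((k - z) / 2) / w ^ k := by
    intro w hw
    rw [eisKernel_eq hw, sq, Complex.ofReal_mul, Complex.mul_cpow_ofReal_nonneg (norm_nonneg w)
      (norm_nonneg w), ← Complex.cpow_add _ _ (by simpa using hw), add_halves]
  refine (hquot.congr_of_eventuallyEq ?_).congr_deriv ?_
  · filter_upwards [hlin.continuousAt.eventually_ne hu] with y hy using hsqrt _ hy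
  · have hk : (k : ℂ) * (u + x) ^ (k - 1) = k * (u + x) ^ k / (u + x) := by
      rcases k with _ | k
      · simp
      · rw [Nat.add_sub_cancel, pow_succ, eq_div_iff hu, mul_assoc]
    have hN : ((‖u + x‖ ^ 2 : ℝ) : ℂ) ≠ 0 := by exact_mod_cast hpos.ne'
    rw [eisKernelLogDeriv, hsqrt _ hu, hk, Complex.cpow_sub _ _ hN, Complex.cpow_one]
    push_cast at hN ⊢
    field_simp

lemma norm_eisKernelLogDeriv_le (k : ℕ) (z : ℂ) {u : ℂ} (hu : u ≠ 0) :
    ‖eisKernelLogDeriv k z u‖ ≤ (2 * k + ‖z‖) / ‖u‖ := by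
  have hu' : 0 < ‖u‖ := norm_pos_iff.mpr hu
  have hre : ‖((u.re / ‖u‖ ^ 2 : ℝ) : ℂ)‖ ≤ 1 / ‖u‖ := by
    rw [Complex.norm_real, norm_div, norm_pow, norm_norm, div_le_div_iff₀ (by positivity) hu', sq,
      one_mul]
    gcongr
    exact Complex.abs_re_le_norm u
  calc ‖eisKernelLogDeriv k z u‖
      ≤ ‖(k : ℂ) - z‖ * (1 / ‖u‖) + ‖(k : ℂ) / u‖ := by
        refine (norm_sub_le _ _).trans ?_
        rw [norm_mul]
        gcongr
    _ ≤ (k + ‖z‖) * (1 / ‖u‖) + k / ‖u‖ := by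
        rw [norm_div, Complex.norm_natCast]
        gcongr
        simpa using norm_sub_le (k : ℂ) z
    _ = (2 * k + ‖z‖) / ‖u‖ := by ring

end Kernel

section LineIntegral

open MeasureTheory Filter

lemma add_ofReal_ne_zero {u : ℂ} (hu : u.im ≠ 0) (x : ℝ) : u + x ≠ 0 := fun h =>
  hu (by simpa using congrArg Complex.im h)

lemma I_add_ne_zero (x : ℝ) : Complex.I + (x : ℂ) ≠ 0 := add_ofReal_ne_zero (by simp) x

lemma continuous_eisKernel_add_ofReal (k : ℕ) (z : ℂ) {u : ℂ} (hu : u.im ≠ 0) :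
    Continuous fun x : ℝ => eisKernel k z (u + x) :=
  continuous_iff_continuousAt.mpr fun x =>
    (hasDerivAt_eisKernel_add_ofReal k z (add_ofReal_ne_zero hu x)).continuousAt

lemma integrable_norm_I_add_rpow {r : ℝ} (hr : 1 < r) :
    Integrable fun x : ℝ => ‖Complex.I + x‖ ^ (-r) := by
  refine (integrable_rpow_neg_one_add_norm_sq (E := ℝ) (μ := volume) (r := r)
    (by simpa using hr)).congr (Eventually.of_forall fun x => ?_)
  have hnorm : 1 + ‖x‖ ^ 2 = ‖Complex.I + x‖ ^ (2 : ℝ) := by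
    rw [Real.rpow_two, ← Complex.normSq_eq_norm_sq, Complex.normSq_apply]
    simp [sq, add_comm]
  simp only [hnorm, ← Real.rpow_mul (norm_nonneg _)]
  congr 1
  ring

/-- The integral of `eisKernel k z` along the line `Im u = 1`. -/
noncomputable def lineIntegral (k : ℕ) (z : ℂ) : ℂ := ∫ x : ℝ, eisKernel k z (Complex.I + x)

lemma integrable_eisKernel_I_add (k : ℕ) {z : ℂ} (hz : 1 < z.re) :
    Integrable fun x : ℝ => eisKernel k z (Complex.I + x) :=
  (integrable_norm_I_add_rpow hz).mono'
    (continuous_eisKernel_add_ofReal k z (by simp)).aestronglyMeasurable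
    (Eventually.of_forall fun x => (norm_eisKernel k z (I_add_ne_zero x)).le)

lemma differentiableOn_lineIntegral (k : ℕ) :
    DifferentiableOn ℂ (lineIntegral k) {z | 1 < z.re} :=
  differentiableOn_integral_of_norm_le_rpow (C := fun _ => 1) (e := 0) continuous_const
    (by norm_num) (fun _ => norm_nonneg _)
    (fun x => (differentiable_eisKernel (.inr (I_add_ne_zero x))).differentiableOn)
    (fun _ hz => (integrable_eisKernel_I_add k hz).aestronglyMeasurable)
    (fun z _ x => by rw [norm_eisKernel k z (I_add_ne_zero x), one_mul, add_zero])
    (fun q hq => by simpa only [add_zero] using integrable_norm_I_add_rpow hq)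

lemma ofReal_sub_I_ne_zero (x : ℝ) : (x : ℂ) - Complex.I ≠ 0 := by
  rw [sub_eq_neg_add]
  exact add_ofReal_ne_zero (by simp) x

lemma eisKernel_two_mul_two {m : ℕ} (hm : m ≠ 0) (x : ℝ) :
    eisKernel (2 * m) 2 (Complex.I + x) =
      ((x - Complex.I) / (x + Complex.I)) ^ (m - 1) / (x + Complex.I) ^ 2 := by
  obtain ⟨n, rfl⟩ := Nat.exists_eq_succ_of_ne_zero hm
  have hne : (x : ℂ) + Complex.I ≠ 0 := by rw [add_comm]; exact I_add_ne_zero x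
  have hne' := ofReal_sub_I_ne_zero x
  have hsq : (‖Complex.I + x‖ : ℂ) ^ 2 = (x + Complex.I) * (x - Complex.I) := by
    rw [← Complex.ofReal_pow, ← Complex.normSq_eq_norm_sq, ← Complex.mul_conj]
    simp only [map_add, Complex.conj_I, Complex.conj_ofReal]
    ring
  rw [eisKernel, div_pow, pow_mul, hsq, Complex.cpow_neg, Complex.cpow_ofNat, hsq,
    Nat.succ_sub_one, add_comm Complex.I, Nat.succ_eq_add_one, mul_pow, div_pow]
  field_simp
  ring

lemma tendsto_sub_I_div_add_I {l : Filter ℝ} (hl : Tendsto (fun x : ℝ => |x|) l atTop) :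
    Tendsto (fun x : ℝ => ((x : ℂ) - Complex.I) / (x + Complex.I)) l (𝓝 1) := by
  have hinv : Tendsto (fun x : ℝ => (Complex.I + (x : ℂ))⁻¹) l (𝓝 0) := by
    refine tendsto_inv₀_cobounded.comp (tendsto_norm_atTop_iff_cobounded.mp
      (tendsto_atTop_mono (fun x => ?_) hl))
    simpa using Complex.abs_re_le_norm (Complex.I + x)
  have hlim := (hinv.const_mul (2 * Complex.I)).const_sub 1
  rw [mul_zero, sub_zero] at hlim
  refine hlim.congr fun x => ?_
  have hne := I_add_ne_zero x
  rw [add_comm (x : ℂ)]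
  field_simp
  ring

lemma hasDerivAt_sub_I_div_add_I_pow {m : ℕ} (hm : m ≠ 0) (x : ℝ) :
    HasDerivAt (fun x : ℝ => (((x : ℂ) - Complex.I) / (x + Complex.I)) ^ m / (2 * m * Complex.I))
      (eisKernel (2 * m) 2 (Complex.I + x)) x := by
  have hne : (x : ℂ) + Complex.I ≠ 0 := by rw [add_comm]; exact I_add_ne_zero x
  have hofReal : HasDerivAt (fun x : ℝ => (x : ℂ)) 1 x := Complex.ofRealCLM.hasDerivAt
  refine ((((hofReal.sub_const Complex.I).fun_div (hofReal.add_const Complex.I) hne).fun_pow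
    m).div_const _).congr_deriv ?_
  have hm' : (m : ℂ) ≠ 0 := by exact_mod_cast hm
  rw [eisKernel_two_mul_two hm]
  field_simp [Complex.I_ne_zero]
  ring

-- In terms of `w = (x - i) / (x + i)` the integrand is the derivative of `wᵐ / (2 m i)`, and `w`
-- has the same limit at both ends of the line.
lemma lineIntegral_two_mul_two {m : ℕ} (hm : m ≠ 0) : lineIntegral (2 * m) 2 = 0 := by
  have hlim := fun l (hl : Tendsto (fun x : ℝ => |x|) l atTop) =>
    ((tendsto_sub_I_div_add_I hl).pow m).div_const (2 * m * Complex.I)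
  rw [lineIntegral, integral_of_hasDerivAt_of_tendsto (hasDerivAt_sub_I_div_add_I_pow hm)
    (integrable_eisKernel_I_add _ (by norm_num)) (hlim _ tendsto_abs_atBot_atTop)
    (hlim _ tendsto_abs_atTop_atTop), sub_self]

lemma eisKernel_add_ofReal_of_im_pos (k : ℕ) (z : ℂ) {u : ℂ} (hu : 0 < u.im) (x : ℝ) :
    eisKernel k z (u + x) =
      (u.im : ℂ) ^ (-z) * eisKernel k z (Complex.I + ((u.re + x) / u.im : ℝ)) := by
  have hu' : (u.im : ℂ) ≠ 0 := by exact_mod_cast hu.ne'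
  rw [← eisKernel_ofReal_mul k z _ hu]
  congr 1
  conv_lhs => rw [← Complex.re_add_im u]
  push_cast
  field_simp
  ring

lemma eisKernel_add_ofReal_neg (k : ℕ) (z u : ℂ) (x : ℝ) :
    eisKernel k z (u + x) = (-1) ^ k * eisKernel k z (-u + (-x : ℝ)) := by
  rw [← eisKernel_neg]
  push_cast
  congr 1
  ring

lemma integrable_eisKernel_add_ofReal (k : ℕ) {z u : ℂ} (hz : 1 < z.re) (hu : u.im ≠ 0) :
    Integrable fun x : ℝ => eisKernel k z (u + x) := by
  wlog hpos : 0 < u.im generalizing u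
  · have hneg : 0 < (-u).im := by simpa using lt_of_le_of_ne (not_lt.mp hpos) hu
    simp_rw [eisKernel_add_ofReal_neg k z u]
    exact (this hneg.ne' hneg).comp_neg.const_mul _
  · simp_rw [eisKernel_add_ofReal_of_im_pos k z hpos]
    exact (((integrable_eisKernel_I_add k hz).comp_div hpos.ne').comp_add_left u.re).const_mul _

lemma integral_eisKernel_add_ofReal (k : ℕ) (z : ℂ) {u : ℂ} (hu : u.im ≠ 0) :
    ∫ x : ℝ, eisKernel k z (u + x) =
      (SignType.sign u.im : ℂ) ^ k * (|u.im| : ℝ) ^ (1 - z) * lineIntegral k z := by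
  wlog hpos : 0 < u.im generalizing u
  · have hneg : 0 < (-u).im := by simpa using lt_of_le_of_ne (not_lt.mp hpos) hu
    simp_rw [eisKernel_add_ofReal_neg k z u]
    rw [integral_const_mul, integral_neg_eq_self fun x : ℝ => eisKernel k z (-u + x),
      this hneg.ne' hneg, sign_pos hneg, sign_neg (by simpa using hneg), Complex.neg_im, abs_neg]
    simp [mul_assoc]
  · have hu' : (u.im : ℂ) ≠ 0 := by exact_mod_cast hu
    simp_rw [eisKernel_add_ofReal_of_im_pos k z hpos]
    rw [integral_const_mul, integral_add_left_eq_self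
      (fun x : ℝ => eisKernel k z (Complex.I + (x / u.im : ℝ))) u.re,
      Measure.integral_comp_div (fun x : ℝ => eisKernel k z (Complex.I + x)), sign_pos hpos,
      abs_of_pos hpos, sub_eq_neg_add, Complex.cpow_add _ _ hu', Complex.cpow_one,
      Complex.real_smul, lineIntegral]
    simp [mul_assoc]

end LineIntegral

section Hurwitz

open HurwitzZeta Filter

lemma eisKernel_ofReal {k : ℕ} (hk : k ≠ 0) (z : ℂ) (x : ℝ) :
    eisKernel k z x = (SignType.sign x : ℂ) ^ k * (|x| : ℝ) ^ (-z) := by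
  rcases lt_trichotomy x 0 with h | rfl | h
  · have hx : (x : ℂ) ≠ 0 := by exact_mod_cast h.ne
    rw [eisKernel, Complex.norm_real, Real.norm_eq_abs, sign_neg h, abs_of_neg h]
    simp [hx]
  · simp [eisKernel_zero hk, hk]
  · have hx : (x : ℂ) ≠ 0 := by exact_mod_cast h.ne'
    rw [eisKernel, Complex.norm_real, Real.norm_eq_abs, sign_pos h, abs_of_pos h]
    simp [hx]

/-- The two-sided Hurwitz zeta function `∑ₙ sgn(n + x)ᵏ |n + x|⁻ᶻ` over all integers `n`, for
`k ≥ 1`. -/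
noncomputable def signedHurwitz (k : ℕ) (x : ℝ) (z : ℂ) : ℂ :=
  2 * if Even k then hurwitzZetaEven x z else hurwitzZetaOdd x z

lemma hasSum_signedHurwitz {k : ℕ} (hk : k ≠ 0) (x : ℝ) {z : ℂ} (hz : 1 < z.re) :
    HasSum (fun n : ℤ => eisKernel k z (n + x)) (signedHurwitz k x z) := by
  have hz0 : z ≠ 0 := fun h => by norm_num [h] at hz
  have hcast : ∀ n : ℤ, (n : ℂ) + x = ((n + x : ℝ) : ℂ) := fun n => by push_cast; rfl
  simp_rw [hcast, eisKernel_ofReal hk, Complex.cpow_neg, signedHurwitz]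
  split_ifs with hev
  · refine ((hasSum_int_hurwitzZetaEven x hz).mul_left 2).congr_fun fun n => ?_
    rcases lt_trichotomy ((n : ℝ) + x) 0 with h | h | h
    · simp [sign_neg h, hev.neg_one_pow]
      ring
    · simp [h, hk, Complex.zero_cpow hz0]
    · simp [sign_pos h]
      ring
  · have hodd := Nat.not_even_iff_odd.mp hev
    refine ((hasSum_int_hurwitzZetaOdd x hz).mul_left 2).congr_fun fun n => ?_
    rcases lt_trichotomy ((n : ℝ) + x) 0 with h | h | h
    · simp [sign_neg h, hodd.neg_one_pow, neg_div]
      ring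
    · simp [h, hk]
    · simp [sign_pos h]
      ring

lemma differentiableAt_signedHurwitz (k : ℕ) (x : ℝ) {z : ℂ} (hz : z ≠ 1) :
    DifferentiableAt ℂ (signedHurwitz k x) z := by
  unfold signedHurwitz
  split_ifs
  · exact (differentiableAt_hurwitzZetaEven x hz).const_mul 2
  · exact (differentiable_hurwitzZetaOdd x z).const_mul 2

lemma exists_differentiable_sub_one_mul_hurwitzZetaEven (a : UnitAddCircle) :
    ∃ K : ℂ → ℂ, Differentiable ℂ K ∧ ∀ z ≠ 1, K z = (z - 1) * hurwitzZetaEven a z := by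
  have heq : Set.EqOn (Function.update (fun z => (z - 1) * hurwitzZetaEven a z) 1 1)
      (fun z => (z - 1) * hurwitzZetaEven a z) {1}ᶜ := fun z hz => Function.update_of_ne hz _ _
  refine ⟨_, differentiableOn_univ.mp
    ((Complex.differentiableOn_compl_singleton_and_continuousAt_iff univ_mem).mp
      ⟨DifferentiableOn.congr (f := fun z => (z - 1) * hurwitzZetaEven a z) (fun z hz => ?_) ?_,
        continuousAt_update_same.mpr (hurwitzZetaEven_residue_one a)⟩), fun z hz => heq hz⟩
  · exact ((differentiableAt_id.sub_const 1).mul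
      (differentiableAt_hurwitzZetaEven a hz.2)).differentiableWithinAt
  · exact heq.mono fun z hz => hz.2

-- For even `k` the pole of the Hurwitz zeta function is cancelled by the zero of the line integral.
lemma exists_continuation_lineIntegral_mul_signedHurwitz {k : ℕ} (hk : k ≠ 0) (x : ℝ) :
    ∃ H : ℂ → ℂ, DifferentiableOn ℂ H {z | 1 < z.re} ∧
      ∀ z ≠ 2, H z = lineIntegral k z * signedHurwitz k x (z - 1) := by
  unfold signedHurwitz
  split_ifs with hev
  · obtain ⟨m, rfl⟩ := hev.two_dvd
    obtain ⟨K, hK, hK'⟩ := exists_differentiable_sub_one_mul_hurwitzZetaEven x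
    have hzero : lineIntegral (2 * m) 2 = 0 := lineIntegral_two_mul_two (by simpa using hk)
    refine ⟨fun z => dslope (lineIntegral (2 * m)) 2 z * (2 * K (z - 1)),
      ((Complex.differentiableOn_dslope ((isOpen_lt_re 1).mem_nhds (by norm_num))).mpr
        (differentiableOn_lineIntegral _)).mul
        ((hK.comp (differentiable_id.sub_const 1)).const_mul 2).differentiableOn, fun z hz => ?_⟩
    have hz1 : z - 1 ≠ 1 := fun h => hz (by linear_combination h)
    have hz2 : z - 2 ≠ 0 := sub_ne_zero.mpr hz
    simp only [dslope_of_ne _ hz, slope_def_field, hzero, hK' _ hz1, sub_zero, sub_sub,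
      one_add_one_eq_two]
    field_simp
  · exact ⟨fun z => lineIntegral k z * (2 * hurwitzZetaOdd x (z - 1)),
      (differentiableOn_lineIntegral k).mul (((differentiable_hurwitzZetaOdd x).comp
        (differentiable_id.sub_const 1)).const_mul 2).differentiableOn, fun _ _ => rfl⟩

end Hurwitz

section Cell

open MeasureTheory

/-- The mean of `eisKernel k z` over the horizontal segment from `u` to `u + 1`; on the real line,
where the kernel may be singular, it is replaced by the value at `u`. -/
noncomputable def cellMean (k : ℕ) (z u : ℂ) : ℂ :=
  if u.im = 0 then eisKernel k z u else ∫ x in (0 : ℝ)..1, eisKernel k z (u + x)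

lemma norm_le_mul_norm_add_ofReal {u : ℂ} {δ : ℝ} (hδ : 0 < δ) (hu : δ ≤ |u.im|) {t : ℝ}
    (ht : t ∈ Set.Icc (0 : ℝ) 1) : ‖u‖ ≤ (1 + δ⁻¹) * ‖u + t‖ := by
  have him : 1 ≤ δ⁻¹ * ‖u + t‖ := by
    rw [← div_eq_inv_mul, one_le_div hδ]
    simpa using hu.trans (by simpa using Complex.abs_im_le_norm (u + t))
  have htri : ‖u‖ ≤ ‖u + t‖ + |t| := by simpa using norm_sub_le (u + t) t
  linarith [abs_le.mpr ⟨by linarith [ht.1], ht.2⟩]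

lemma norm_eisKernel_add_ofReal_mul_logDeriv_le (k : ℕ) {z u : ℂ} (hz : -1 ≤ z.re) {δ : ℝ}
    (hδ : 0 < δ) (hu : δ ≤ |u.im|) {t : ℝ} (ht : t ∈ Set.Icc (0 : ℝ) 1) :
    ‖eisKernel k z (u + t) * eisKernelLogDeriv k z (u + t)‖ ≤
      (2 * k + ‖z‖) * (1 + δ⁻¹) ^ (z.re + 1) * ‖u‖ ^ (-(z.re + 1)) := by
  have hne : u.im ≠ 0 := abs_pos.mp (hδ.trans_le hu)
  have hupos : 0 < ‖u‖ := norm_pos_iff.mpr fun h => hne (by simp [h])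
  have hpos : 0 < ‖u + t‖ := norm_pos_iff.mpr (add_ofReal_ne_zero hne t)
  have hrpow : ‖u + t‖ ^ (-(z.re + 1)) ≤ (1 + δ⁻¹) ^ (z.re + 1) * ‖u‖ ^ (-(z.re + 1)) := by
    have := Real.rpow_le_rpow_of_nonpos (by positivity)
      ((div_le_iff₀' (by positivity)).mpr (norm_le_mul_norm_add_ofReal hδ hu ht))
      (neg_nonpos.mpr (by linarith : 0 ≤ z.re + 1))
    rwa [Real.div_rpow hupos.le (by positivity), Real.rpow_neg (x := 1 + δ⁻¹) (by positivity),
      div_inv_eq_mul, mul_comm] at this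
  calc ‖eisKernel k z (u + t) * eisKernelLogDeriv k z (u + t)‖
      ≤ ‖u + t‖ ^ (-z.re) * ((2 * k + ‖z‖) / ‖u + t‖) := by
        rw [norm_mul, norm_eisKernel k z (norm_pos_iff.mp hpos)]
        gcongr
        exact norm_eisKernelLogDeriv_le k z (norm_pos_iff.mp hpos)
    _ = (2 * k + ‖z‖) * ‖u + t‖ ^ (-(z.re + 1)) := by
        rw [neg_add', Real.rpow_sub_one hpos.ne']
        ring
    _ ≤ _ := by
        rw [mul_assoc]
        gcongr

lemma norm_eisKernel_sub_cellMean_le (k : ℕ) {z u : ℂ} (hz : -1 ≤ z.re) {δ : ℝ} (hδ : 0 < δ)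
    (hu : u.im ≠ 0 → δ ≤ |u.im|) :
    ‖eisKernel k z u - cellMean k z u‖ ≤
      (2 * k + ‖z‖) * (1 + δ⁻¹) ^ (z.re + 1) * ‖u‖ ^ (-(z.re + 1)) := by
  set M := (2 * k + ‖z‖) * (1 + δ⁻¹) ^ (z.re + 1) * ‖u‖ ^ (-(z.re + 1))
  by_cases him : u.im = 0
  · rw [cellMean, if_pos him, sub_self, norm_zero]
    positivity
  have hmean : ∀ t ∈ Set.Icc (0 : ℝ) 1, ‖eisKernel k z (u + t) - eisKernel k z u‖ ≤ M := by
    intro t ht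
    have := Convex.norm_image_sub_le_of_norm_hasDerivWithin_le
      (f := fun x : ℝ => eisKernel k z (u + x))
      (fun x _ => (hasDerivAt_eisKernel_add_ofReal k z
        (add_ofReal_ne_zero him x)).hasDerivWithinAt)
      (fun x hx => norm_eisKernel_add_ofReal_mul_logDeriv_le k hz hδ (hu him) hx)
      (convex_Icc 0 1) (Set.left_mem_Icc.mpr zero_le_one) ht
    rw [Complex.ofReal_zero, add_zero, sub_zero, Real.norm_eq_abs, abs_of_nonneg ht.1] at this
    exact this.trans (mul_le_of_le_one_right (by positivity) ht.2)
  have hint : cellMean k z u - eisKernel k z u =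
      ∫ x in (0 : ℝ)..1, (eisKernel k z (u + x) - eisKernel k z u) := by
    rw [cellMean, if_neg him, intervalIntegral.integral_sub
      ((continuous_eisKernel_add_ofReal k z him).intervalIntegrable _ _)
      intervalIntegrable_const]
    simp
  rw [norm_sub_rev, hint]
  simpa using intervalIntegral.norm_integral_le_of_norm_le_const (a := (0 : ℝ)) (b := 1)
    (C := M) (fun x hx => hmean x (by
      rw [Set.uIoc_of_le zero_le_one] at hx
      exact Set.Ioc_subset_Icc_self hx))

lemma differentiableOn_cellMean {k : ℕ} (hk : k ≠ 0) (u : ℂ) :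
    DifferentiableOn ℂ (fun z => cellMean k z u) {z | 1 < z.re} := by
  unfold cellMean
  split_ifs with him
  · exact (differentiable_eisKernel (.inl hk)).differentiableOn
  · simp_rw [intervalIntegral.integral_of_le zero_le_one]
    have hne := add_ofReal_ne_zero him
    exact differentiableOn_integral_of_norm_le_rpow (C := fun _ => 1) (e := 0)
      (x := fun x : ℝ => ‖u + x‖) continuous_const
      (by norm_num) (fun _ => norm_nonneg _)
      (fun x => (differentiable_eisKernel (.inr (hne x))).differentiableOn)
      (fun _ _ => (continuous_eisKernel_add_ofReal k _ him).aestronglyMeasurable)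
      (fun z _ x => by rw [norm_eisKernel k z (hne x), one_mul, add_zero])
      (fun q _ => ((Continuous.rpow_const (by fun_prop)
        fun x => Or.inl (norm_ne_zero_iff.mpr (hne x))).integrableOn_Icc).mono_set
          Set.Ioc_subset_Icc_self)

/-- The sum of `eisKernel k z` over a horizontal row `u + ℤ` of points when it is replaced by its
means over the cells of the row. -/
noncomputable def rowMean (k : ℕ) (z u : ℂ) : ℂ :=
  if u.im = 0 then signedHurwitz k u.re z
  else (SignType.sign u.im : ℂ) ^ k * (|u.im| : ℝ) ^ (1 - z) * lineIntegral k z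

lemma hasSum_cellMean_add_intCast {k : ℕ} (hk : k ≠ 0) {z : ℂ} (hz : 1 < z.re) (u : ℂ) :
    HasSum (fun n : ℤ => cellMean k z (u + n)) (rowMean k z u) := by
  by_cases him : u.im = 0
  · have hu : u = u.re := Complex.ext rfl (by simp [him])
    rw [rowMean, if_pos him]
    refine (hasSum_signedHurwitz hk u.re hz).congr_fun fun n => ?_
    rw [cellMean, if_pos (by simp [him]), hu, Complex.ofReal_re, add_comm]
  · rw [rowMean, if_neg him, ← integral_eisKernel_add_ofReal k z him]
    refine ((integrable_eisKernel_add_ofReal k hz him).hasSum_intervalIntegral 0).congr_fun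
      fun n => ?_
    have hshift := intervalIntegral.integral_comp_add_right (a := 0) (b := 1)
      (fun x : ℝ => eisKernel k z (u + x)) (n : ℝ)
    rw [cellMean, if_neg (by simpa using him)]
    simpa [add_comm, add_left_comm] using hshift

end Cell

section LatticeSum

lemma exists_pos_le_abs_intCast_add (α : ℝ) :
    ∃ δ > 0, ∀ l : ℤ, (l : ℝ) + α ≠ 0 → δ ≤ |l + α| := by
  by_cases hα : α - round α = 0
  · refine ⟨1, one_pos, fun l hl => ?_⟩
    rw [sub_eq_zero.mp hα] at hl ⊢
    exact_mod_cast Int.one_le_abs (by exact_mod_cast hl)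
  · refine ⟨|α - round α|, abs_pos.mpr hα, fun l _ => ?_⟩
    simpa [add_comm] using round_le α (-l)

lemma im_add_intCast_mul (τ : ℍ) (v : ℂ) (l : ℤ) :
    (v + l * τ).im = τ.im * (l + v.im / τ.im) := by
  have := τ.im_ne_zero
  rw [Complex.add_im, Complex.mul_im, Complex.intCast_re, Complex.intCast_im, zero_mul, add_zero,
    coe_im]
  field_simp
  ring

lemma exists_pos_le_abs_im_add_intCast_mul (τ : ℍ) (v : ℂ) :
    ∃ δ > 0, ∀ l : ℤ, (v + l * τ).im ≠ 0 → δ ≤ |(v + l * τ).im| := by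
  obtain ⟨δ, hδ, hle⟩ := exists_pos_le_abs_intCast_add (v.im / τ.im)
  refine ⟨τ.im * δ, mul_pos τ.im_pos hδ, fun l hl => ?_⟩
  rw [im_add_intCast_mul] at hl ⊢
  rw [abs_mul, abs_of_pos τ.im_pos]
  exact mul_le_mul_of_nonneg_left (hle l (right_ne_zero_of_mul hl)) τ.im_pos.le

lemma rowMean_add_intCast_mul {k : ℕ} (hk : k ≠ 0) (z : ℂ) (τ : ℍ) (v : ℂ) (l : ℤ) :
    rowMean k z (v + l * τ) =
      (τ.im : ℂ) ^ (1 - z) * lineIntegral k z * eisKernel k (z - 1) (l + (v.im / τ.im : ℝ)) +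
        if (l : ℝ) + v.im / τ.im = 0 then signedHurwitz k (v + l * τ).re z else 0 := by
  set α := v.im / τ.im
  have hcast : (l : ℂ) + (α : ℝ) = ((l + α : ℝ) : ℂ) := by push_cast; rfl
  rw [rowMean, im_add_intCast_mul, hcast, eisKernel_ofReal hk, neg_sub]
  by_cases hl : (l : ℝ) + α = 0
  · rw [if_pos (by rw [hl, mul_zero]), if_pos hl, hl]
    simp [hk]
  · rw [if_neg (mul_ne_zero τ.im_ne_zero hl), if_neg hl, sign_mul, sign_pos τ.im_pos, abs_mul,
      abs_of_pos τ.im_pos, Complex.ofReal_mul,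
      Complex.mul_cpow_ofReal_nonneg τ.im_pos.le (abs_nonneg _)]
    simp
    ring

lemma exists_hasSum_ite_signedHurwitz (k : ℕ) (τ : ℍ) (v : ℂ) :
    ∃ J : ℂ → ℂ, DifferentiableOn ℂ J {z | 1 < z.re} ∧ ∀ z, HasSum (fun l : ℤ =>
      if (l : ℝ) + v.im / τ.im = 0 then signedHurwitz k (v + l * τ).re z else 0) (J z) := by
  by_cases hex : ∃ l : ℤ, (l : ℝ) + v.im / τ.im = 0
  · obtain ⟨l₀, hl₀⟩ := hex
    refine ⟨signedHurwitz k (v + l₀ * τ).re, fun z hz =>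
      (differentiableAt_signedHurwitz k _ fun h => ?_).differentiableWithinAt, fun z => ?_⟩
    · norm_num [h] at hz
    · convert hasSum_single l₀ fun l hl => if_neg fun h => hl ?_ using 1
      · rw [if_pos hl₀]
      · exact_mod_cast add_right_cancel (h.trans hl₀.symm)
  · refine ⟨fun _ => 0, differentiableOn_const 0, fun z => ?_⟩
    convert hasSum_zero using 2 with l
    exact if_neg fun h => hex ⟨l, h⟩

lemma exists_continuation_sum_rowMean {k : ℕ} (hk : k ≠ 0) (τ : ℍ) (v : ℂ) :
    ∃ R : ℂ → ℂ, DifferentiableOn ℂ R {z | 1 < z.re} ∧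
      ∀ z, 2 < z.re → HasSum (fun l : ℤ => rowMean k z (v + l * τ)) (R z) := by
  obtain ⟨H, hH, hH'⟩ := exists_continuation_lineIntegral_mul_signedHurwitz hk (v.im / τ.im)
  obtain ⟨J, hJ, hJ'⟩ := exists_hasSum_ite_signedHurwitz k τ v
  refine ⟨fun z => (τ.im : ℂ) ^ (1 - z) * H z + J z,
    (DifferentiableOn.mul (fun z _ => ?_) hH).add hJ, fun z hz => ?_⟩
  · exact (DifferentiableAt.const_cpow (by fun_prop)
      (Or.inl (by exact_mod_cast τ.im_ne_zero))).differentiableWithinAt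
  · have hz1 : 1 < (z - 1).re := by
      rw [Complex.sub_re, Complex.one_re]
      linarith
    simp_rw [rowMean_add_intCast_mul hk]
    rw [hH' z (fun h => by norm_num [h] at hz), ← mul_assoc]
    exact ((hasSum_signedHurwitz hk _ hz1).mul_left _).add (hJ' z)

/-- The period pair `(τ, 1)` of a point of the upper half-plane. -/
noncomputable def periodPair (τ : ℍ) : PeriodPair where
  ω₁ := τ
  ω₂ := 1
  indep := by
    refine LinearIndependent.pair_iff.mpr fun s t h => ?_
    have hs : s = 0 := by simpa [τ.im_ne_zero] using congrArg Complex.im h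
    exact ⟨hs, by simpa [hs] using h⟩

lemma summable_norm_add_rpow (τ : ℍ) (v : ℂ) {q : ℝ} (hq : 2 < q) :
    Summable fun p : ℤ × ℤ => ‖v + p.1 * τ + p.2‖ ^ (-q) := by
  have hsum := ZLattice.summable_norm_sub_rpow (periodPair τ).lattice (-q)
    (by simpa using hq) (-v)
  refine ((periodPair τ).latticeEquivProd.symm.toEquiv.summable_iff.mpr hsum).congr fun p => ?_
  simp only [Function.comp_apply, LinearEquiv.coe_toEquiv, (periodPair τ).latticeEquiv_symm_apply]
  congr 2
  simp only [periodPair]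
  ring

lemma norm_eisKernel_le {k : ℕ} (hk : k ≠ 0) (z u : ℂ) : ‖eisKernel k z u‖ ≤ ‖u‖ ^ (-z.re) := by
  rcases eq_or_ne u 0 with rfl | hu
  · rw [eisKernel_zero hk, norm_zero]
    positivity
  · exact (norm_eisKernel k z hu).le

lemma summable_eisKernel {k : ℕ} (hk : k ≠ 0) (τ : ℍ) (v : ℂ) {z : ℂ} (hz : 2 < z.re) :
    Summable fun p : ℤ × ℤ => eisKernel k z (v + p.1 * τ + p.2) :=
  (summable_norm_add_rpow τ v hz).of_norm_bounded fun _ => norm_eisKernel_le hk z _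

lemma exists_norm_eisKernel_sub_cellMean_le (k : ℕ) (τ : ℍ) (v : ℂ) :
    ∃ C : ℂ → ℝ, Continuous C ∧ ∀ z : ℂ, 1 < z.re → ∀ p : ℤ × ℤ,
      ‖eisKernel k z (v + p.1 * τ + p.2) - cellMean k z (v + p.1 * τ + p.2)‖ ≤
        C z * ‖v + p.1 * τ + p.2‖ ^ (-(z.re + 1)) := by
  obtain ⟨δ, hδ, hle⟩ := exists_pos_le_abs_im_add_intCast_mul τ v
  refine ⟨fun z => (2 * k + ‖z‖) * (1 + δ⁻¹) ^ (z.re + 1), ?_, fun z hz p =>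
    norm_eisKernel_sub_cellMean_le k (by linarith) hδ (by simpa using hle p.1)⟩
  exact Continuous.mul (by fun_prop)
    (continuous_const.rpow (by fun_prop) fun _ => Or.inl (by positivity))

lemma differentiableOn_tsum_eisKernel_sub_cellMean {k : ℕ} (hk : k ≠ 0) (τ : ℍ) (v : ℂ) :
    DifferentiableOn ℂ (fun z => ∑' p : ℤ × ℤ,
      (eisKernel k z (v + p.1 * τ + p.2) - cellMean k z (v + p.1 * τ + p.2)))
      {z | 1 < z.re} := by
  obtain ⟨C, hC, hle⟩ := exists_norm_eisKernel_sub_cellMean_le k τ v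
  exact differentiableOn_tsum_of_norm_le_rpow hC (e := 1) (by norm_num)
    (fun _ => norm_nonneg _) (fun _ =>
      (differentiable_eisKernel (.inl hk)).differentiableOn.sub (differentiableOn_cellMean hk _))
    hle fun q hq => summable_norm_add_rpow τ v (by linarith)

lemma exists_continuation_latticeSum {k : ℕ} (hk : k ≠ 0) (τ : ℍ) (v : ℂ) :
    ∃ F : ℂ → ℂ, DifferentiableOn ℂ F {z | 1 < z.re} ∧ ∀ z, 2 < z.re →
      HasSum (fun p : ℤ × ℤ => eisKernel k z (v + p.1 * τ + p.2)) (F z) := by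
  obtain ⟨R, hR, hR'⟩ := exists_continuation_sum_rowMean hk τ v
  refine ⟨_, (differentiableOn_tsum_eisKernel_sub_cellMean hk τ v).add hR, fun z hz => ?_⟩
  obtain ⟨C, -, hle⟩ := exists_norm_eisKernel_sub_cellMean_le k τ v
  have hker := (summable_eisKernel hk τ v hz).hasSum
  have hdiff := (((summable_norm_add_rpow τ v (by linarith)).mul_left (C z)).of_norm_bounded
    (hle z (by linarith))).hasSum
  have hmean := hker.sub hdiff
  simp only [sub_sub_cancel] at hmean
  have hrows := hmean.prod_fiberwise fun l =>
    hasSum_cellMean_add_intCast hk (by linarith) (v + l * τ)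
  convert hker using 1
  exact (sub_eq_iff_eq_add'.mp (hrows.unique (hR' z hz))).symm

end LatticeSum

section Level

lemma summable_eisTerm {k : ℕ} (hk : k ≠ 0) (τ : ℍ) {s : ℂ} (hs : 2 < ((k : ℂ) + 2 * s).re) :
    Summable fun w : Fin 2 → ℤ => eisTerm k τ s w := by
  refine ((finTwoArrowEquiv ℤ).summable_iff.mpr
    ((summable_eisKernel hk τ 0 hs).mul_left ((τ.im : ℂ) ^ s))).congr fun w => ?_
  simp [eisTerm_eq hk]

/-- The integral vectors in the residue class of `v`, parametrised by `ℤ × ℤ`. -/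
def congruentVec {N : ℕ} (v : Fin 2 → ZMod N) (p : ℤ × ℤ) : Fin 2 → ℤ :=
  ![(v 0).cast + N * p.1, (v 1).cast + N * p.2]

lemma intCast_congruentVec {N : ℕ} (v : Fin 2 → ZMod N) (p : ℤ × ℤ) :
    (fun i => (congruentVec v p i : ZMod N)) = v := by
  ext i
  fin_cases i <;> simp [congruentVec]

lemma congruentVec_injective {N : ℕ} [NeZero N] (v : Fin 2 → ZMod N) :
    Function.Injective (congruentVec v) := by
  intro p q h
  have hN : (N : ℤ) ≠ 0 := by exact_mod_cast NeZero.ne N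
  have h0 : (N : ℤ) * p.1 = N * q.1 := add_left_cancel (congrFun h 0)
  have h1 : (N : ℤ) * p.2 = N * q.2 := add_left_cancel (congrFun h 1)
  exact Prod.ext (mul_left_cancel₀ hN h0) (mul_left_cancel₀ hN h1)

lemma exists_congruentVec_eq {N : ℕ} {v : Fin 2 → ZMod N} {w : Fin 2 → ℤ}
    (hw : (fun i => (w i : ZMod N)) = v) : ∃ p, congruentVec v p = w := by
  have hdvd : ∀ i, ∃ m : ℤ, ((v i).cast : ℤ) + N * m = w i := by
    intro i
    obtain ⟨m, hm⟩ := (ZMod.intCast_eq_intCast_iff_dvd_sub (v i).cast (w i) N).mp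
      ((ZMod.intCast_zmod_cast (v i)).trans (congrFun hw i).symm)
    exact ⟨m, by linarith⟩
  obtain ⟨l, hl⟩ := hdvd 0
  obtain ⟨m, hm⟩ := hdvd 1
  exact ⟨(l, m), by ext i; fin_cases i <;> assumption⟩

lemma levelG_eq_tsum_congruentVec {k N : ℕ} (hk : k ≠ 0) [NeZero N] (v : Lat N) (τ : ℍ) (s : ℂ) :
    levelG k v τ s = ∑' p, eisTerm k τ s (congruentVec v.val p) := by
  have hzero : eisTerm k τ s 0 = 0 := by simp [eisTerm, hk]
  refine (tsum_subtype {w : Fin 2 → ℤ | (fun i => (w i : ZMod N)) = v.val ∧ w ≠ 0}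
    (eisTerm k τ s)).trans ?_
  rw [← (congruentVec_injective v.val).tsum_eq fun w hw =>
      exists_congruentVec_eq (Set.mem_of_indicator_ne_zero hw).1]
  refine tsum_congr fun p => Set.indicator_apply_eq_self.mpr fun hp => ?_
  rw [of_not_not fun h => hp ⟨intCast_congruentVec v.val p, h⟩, hzero]

lemma eisTerm_congruentVec {k N : ℕ} (hk : k ≠ 0) [NeZero N] (v : Fin 2 → ZMod N) (τ : ℍ) (s : ℂ)
    (p : ℤ × ℤ) :
    eisTerm k τ s (congruentVec v p) = (τ.im : ℂ) ^ s * (N : ℂ) ^ (-(k + 2 * s)) *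
      eisKernel k (k + 2 * s) ((((v 0).cast : ℤ) * τ + ((v 1).cast : ℤ)) / N + p.1 * τ + p.2) := by
  have hN : (N : ℂ) ≠ 0 := by exact_mod_cast NeZero.ne N
  rw [eisTerm_eq hk, mul_assoc, ← Complex.ofReal_natCast N, ← eisKernel_ofReal_mul _ _ _
    (by exact_mod_cast NeZero.pos N)]
  congr 2
  simp only [congruentVec, cons_val_zero, cons_val_one]
  push_cast
  field_simp
  ring

lemma exists_continuation_levelG {k N : ℕ} (hk : k ≠ 0) [NeZero N] (v : Lat N) (τ : ℍ) :
    ∃ F, IsContinuation k (levelG k v τ) F := by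
  obtain ⟨F, hF, hF'⟩ :=
    exists_continuation_latticeSum hk τ ((((v.val 0).cast : ℤ) * τ + ((v.val 1).cast : ℤ)) / N)
  have hlin : Differentiable ℂ fun s : ℂ => (k : ℂ) + 2 * s := by fun_prop
  refine ⟨fun s => (τ.im : ℂ) ^ s * (N : ℂ) ^ (-(k + 2 * s)) * F (k + 2 * s),
    (DifferentiableOn.mul ?_ (hF.comp hlin.differentiableOn fun _ hs => hs)).analyticOnNhd
      ((isOpen_lt_re 1).preimage hlin.continuous), fun s hs => ?_⟩
  · refine Differentiable.differentiableOn (Differentiable.mul ?_ ?_)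
    · exact differentiable_id.const_cpow (Or.inl (by exact_mod_cast τ.im_ne_zero))
    · exact hlin.neg.const_cpow (Or.inl (by exact_mod_cast NeZero.ne N))
  · simp_rw [levelG_eq_tsum_congruentVec hk, eisTerm_congruentVec hk]
    rw [tsum_mul_left, (hF' _ hs).tsum_eq]

end Level

/-! ### Primitive vectors and Möbius inversion -/

section Symmetry

/-- The sum over the vectors in the class of `v` whose entries are coprime: the primitive part of
`levelG k v`. -/
noncomputable def primG (k : ℕ) {N : ℕ} (v : Lat N) (τ : ℍ) (s : ℂ) : ℂ :=
  ∑' w : {w : Fin 2 → ℤ // (fun i => (w i : ZMod N)) = v.val ∧ IsCoprime (w 0) (w 1)},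
    eisTerm k τ s w.1

lemma eisTerm_neg (k : ℕ) (τ : ℍ) (s : ℂ) (w : Fin 2 → ℤ) :
    eisTerm k τ s (-w) = (-1) ^ k * eisTerm k τ s w := by
  have hlin : (((-w) 0 : ℤ) : ℂ) * τ + ((-w) 1 : ℤ) = -((w 0 : ℂ) * τ + w 1) := by
    simp only [Pi.neg_apply]; push_cast; ring
  have hsign : ((-1 : ℂ) ^ k)⁻¹ = (-1) ^ k := by rw [← inv_pow, inv_neg, inv_one]
  rw [eisTerm, eisTerm, hlin, norm_neg, neg_pow, mul_assoc, div_mul_eq_div_div_swap, div_eq_mul_inv,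
    hsign, mul_comm]

lemma eisTerm_nsmul (k : ℕ) (τ : ℍ) (s : ℂ) {n : ℕ} (hn : n ≠ 0) (w : Fin 2 → ℤ) :
    eisTerm k τ s (n • w) = 1 / (n : ℂ) ^ ((k : ℂ) + 2 * s) * eisTerm k τ s w := by
  have hlin : (((n • w) 0 : ℤ) : ℂ) * τ + ((n • w) 1 : ℤ) = n * ((w 0 : ℂ) * τ + w 1) := by
    simp only [Pi.smul_apply, nsmul_eq_mul]; push_cast; ring
  rw [eisTerm, eisTerm, hlin, norm_mul, Complex.norm_natCast, Complex.ofReal_mul,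
    Complex.mul_cpow_ofReal_nonneg n.cast_nonneg (norm_nonneg _), mul_pow, Complex.ofReal_natCast,
    Complex.cpow_add _ _ (by exact_mod_cast hn), Complex.cpow_natCast, div_mul_div_comm, one_mul]
  ring

lemma intCast_neg_eq_iff {N : ℕ} (v : Lat N) (w : Fin 2 → ℤ) :
    (fun i => (((-w) i : ℤ) : ZMod N)) = (-v).val ↔ (fun i => (w i : ZMod N)) = v.val := by
  simp [funext_iff, Lat.neg_val]

lemma levelG_neg (k : ℕ) {N : ℕ} (v : Lat N) (τ : ℍ) (s : ℂ) :
    levelG k (-v) τ s = (-1) ^ k * levelG k v τ s := by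
  rw [levelG, levelG, ← tsum_mul_left,
    ← ((Equiv.neg (Fin 2 → ℤ)).subtypeEquiv fun w =>
      and_congr (intCast_neg_eq_iff v w).symm (neg_ne_zero (a := w)).symm).tsum_eq]
  exact tsum_congr fun w => eisTerm_neg k τ s w

lemma primG_neg (k : ℕ) {N : ℕ} (v : Lat N) (τ : ℍ) (s : ℂ) :
    primG k (-v) τ s = (-1) ^ k * primG k v τ s := by
  rw [primG, primG, ← tsum_mul_left,
    ← ((Equiv.neg (Fin 2 → ℤ)).subtypeEquiv fun w =>
      and_congr (intCast_neg_eq_iff v w).symm (IsCoprime.neg_neg_iff _ _).symm).tsum_eq]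
  exact tsum_congr fun w => eisTerm_neg k τ s w

end Symmetry

section PartialZeta

/-- The arithmetic function `f` cut down to the integers `n` with `n ≡ δ` modulo `N`. -/
noncomputable def classPart {N : ℕ} (δ : ZMod N) (f : ℕ → ℂ) : ℕ → ℂ :=
  Set.indicator {n | (n : ZMod N) = δ} f

lemma tsum_class_eq_LSeries {N : ℕ} (δ : ZMod N) (f : ℕ → ℂ) (z : ℂ) :
    ∑' n : {n : ℕ // 1 ≤ n ∧ (n : ZMod N) = δ}, f n / (n : ℂ) ^ z = LSeries (classPart δ f) z := by
  refine (tsum_subtype {n : ℕ | 1 ≤ n ∧ (n : ZMod N) = δ} fun n => f n / (n : ℂ) ^ z).trans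
    (tsum_congr fun n => ?_)
  rcases n.eq_zero_or_pos with rfl | hn
  · simp
  · by_cases h : (n : ZMod N) = δ <;>
      simp [h, classPart, Nat.one_le_iff_ne_zero, hn.ne']

lemma zetaPlus_eq_LSeries {N : ℕ} (δ : (ZMod N)ˣ) (z : ℂ) :
    zetaPlus δ z = LSeries (classPart (δ : ZMod N) 1) z :=
  tsum_class_eq_LSeries (δ : ZMod N) 1 z

lemma zetaPlusMu_eq_LSeries {N : ℕ} (δ : (ZMod N)ˣ) (z : ℂ) :
    zetaPlusMu δ z =
      LSeries (classPart (δ : ZMod N) fun n => ((ArithmeticFunction.moebius n : ℤ) : ℂ)) z :=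
  tsum_class_eq_LSeries (δ : ZMod N) (fun n => ((ArithmeticFunction.moebius n : ℤ) : ℂ)) z

lemma norm_moebius_le_one (n : ℕ) : ‖((ArithmeticFunction.moebius n : ℤ) : ℂ)‖ ≤ 1 := by
  rw [Complex.norm_intCast]
  exact_mod_cast ArithmeticFunction.abs_moebius_le_one

lemma abscissaOfAbsConv_classPart_le_one {N : ℕ} (δ : ZMod N) {f : ℕ → ℂ} (hf : ∀ n, ‖f n‖ ≤ 1) :
    LSeries.abscissaOfAbsConv (classPart δ f) ≤ 1 :=
  LSeries.abscissaOfAbsConv_le_of_le_const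
    ⟨1, fun n _ => (norm_indicator_le_norm_self f n).trans (hf n)⟩

lemma lseriesSummable_classPart {N : ℕ} (δ : ZMod N) {f : ℕ → ℂ} (hf : ∀ n, ‖f n‖ ≤ 1) {z : ℂ}
    (hz : 1 < z.re) : LSeriesSummable (classPart δ f) z :=
  LSeriesSummable_of_abscissaOfAbsConv_lt_re
    ((abscissaOfAbsConv_classPart_le_one δ hf).trans_lt (by exact_mod_cast hz))

lemma analyticOnNhd_LSeries_classPart (k : ℕ) {N : ℕ} (δ : ZMod N) {f : ℕ → ℂ}
    (hf : ∀ n, ‖f n‖ ≤ 1) :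
    AnalyticOnNhd ℂ (fun s => LSeries (classPart δ f) (k + 2 * s))
      {s | 1 < ((k : ℂ) + 2 * s).re} :=
  (LSeries_analyticOnNhd _).comp (f := fun s : ℂ => (k : ℂ) + 2 * s) (fun s _ => by fun_prop)
    fun _ hs => (abscissaOfAbsConv_classPart_le_one δ hf).trans_lt (by exact_mod_cast hs)

lemma analyticOnNhd_zetaPlus (k : ℕ) {N : ℕ} (δ : (ZMod N)ˣ) :
    AnalyticOnNhd ℂ (fun s => zetaPlus δ (k + 2 * s)) {s | 1 < ((k : ℂ) + 2 * s).re} := by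
  simp_rw [zetaPlus_eq_LSeries]
  exact analyticOnNhd_LSeries_classPart k _ fun _ => by simp

lemma analyticOnNhd_zetaPlusMu (k : ℕ) {N : ℕ} (δ : (ZMod N)ˣ) :
    AnalyticOnNhd ℂ (fun s => zetaPlusMu δ (k + 2 * s)) {s | 1 < ((k : ℂ) + 2 * s).re} := by
  simp_rw [zetaPlusMu_eq_LSeries]
  exact analyticOnNhd_LSeries_classPart k _ norm_moebius_le_one

lemma summable_zetaPlus {N : ℕ} (δ : (ZMod N)ˣ) {z : ℂ} (hz : 1 < z.re) :
    Summable fun n : {n : ℕ // 1 ≤ n ∧ (n : ZMod N) = δ} => 1 / (n : ℂ) ^ z :=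
  (Complex.summable_one_div_nat_cpow.mpr hz).subtype _

lemma sum_classPart_mul_classPart {N : ℕ} [NeZero N] (η : (ZMod N)ˣ) (f g : ℕ → ℂ) (a b : ℕ) :
    ∑ δ : (ZMod N)ˣ, classPart (δ : ZMod N) f a * classPart ((δ⁻¹ * η : (ZMod N)ˣ) : ZMod N) g b =
      classPart (η : ZMod N) (fun _ => f a * g b) (a * b) := by
  classical
  simp only [classPart, Set.indicator_apply, Set.mem_ofPred_eq, Nat.cast_mul]
  by_cases ha : IsUnit (a : ZMod N)
  · obtain ⟨ε, hε⟩ := ha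
    rw [Finset.sum_eq_single ε]
    · simp [← hε, Units.eq_inv_mul_iff_mul_eq]
    · intro δ _ hδ
      rw [if_neg (fun h => hδ (Units.ext (h.symm.trans hε.symm))), zero_mul]
    · simp
  · rw [if_neg fun h => ha (isUnit_of_mul_isUnit_left (h ▸ η.isUnit))]
    refine Finset.sum_eq_zero fun δ _ => ?_
    rw [if_neg fun h : (a : ZMod N) = δ => ha (h ▸ δ.isUnit), zero_mul]

open LSeries (convolution)

lemma sum_convolution_classPart {N : ℕ} [NeZero N] (η : (ZMod N)ˣ) (f g : ℕ → ℂ) :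
    ∑ δ : (ZMod N)ˣ, convolution (classPart (δ : ZMod N) f)
        (classPart ((δ⁻¹ * η : (ZMod N)ˣ) : ZMod N) g) =
      classPart (η : ZMod N) (convolution f g) := by
  ext n
  simp only [Finset.sum_apply, LSeries.convolution_def]
  rw [Finset.sum_comm, Finset.sum_congr rfl fun p hp => by
    rw [sum_classPart_mul_classPart, (Nat.mem_divisorsAntidiagonal.mp hp).1]]
  by_cases hn : (n : ZMod N) = η <;> simp [classPart, hn]

lemma convolution_moebius_one :
    convolution (fun n => ((ArithmeticFunction.moebius n : ℤ) : ℂ)) 1 = LSeries.delta := by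
  rw [LSeries.convolution_one_eq_convolution_zeta, ← ArithmeticFunction.one_eq_delta]
  simp_rw [← ArithmeticFunction.natCoe_apply, ← ArithmeticFunction.intCoe_apply]
  rw [ArithmeticFunction.coe_mul, ArithmeticFunction.coe_moebius_mul_coe_zeta]

lemma classPart_delta {N : ℕ} (η : ZMod N) [Decidable (η = 1)] :
    classPart η LSeries.delta = (if η = 1 then 1 else 0 : ℂ) • LSeries.delta := by
  classical
  ext n
  rcases eq_or_ne n 1 with rfl | hn
  · simp [classPart, Set.indicator_apply, LSeries.delta, eq_comm]
  · simp [classPart, Set.indicator_apply, LSeries.delta, hn]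

lemma sum_zetaPlusMu_mul_zetaPlus {N : ℕ} [NeZero N] (η : (ZMod N)ˣ) [Decidable (η = 1)] {z : ℂ}
    (hz : 1 < z.re) :
    ∑ δ : (ZMod N)ˣ, zetaPlusMu δ z * zetaPlus (δ⁻¹ * η) z = if η = 1 then 1 else 0 := by
  have hμ := fun δ : (ZMod N)ˣ => lseriesSummable_classPart (δ : ZMod N) norm_moebius_le_one hz
  have hone := fun δ : (ZMod N)ˣ =>
    lseriesSummable_classPart (f := 1) (δ : ZMod N) (fun _ => by simp) hz
  simp_rw [zetaPlus_eq_LSeries, zetaPlusMu_eq_LSeries, ← LSeries_convolution' (hμ _) (hone _)]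
  rw [← LSeries_sum fun δ _ => (hμ δ).convolution (hone _), sum_convolution_classPart,
    convolution_moebius_one]
  classical
  rw [classPart_delta, LSeries_smul, LSeries_delta]
  simp

end PartialZeta

section GcdDecomposition

lemma intCast_nsmul {N : ℕ} (n : ℕ) (u : Fin 2 → ℤ) :
    (fun i => (((n • u) i : ℤ) : ZMod N)) = n • fun i => (u i : ZMod N) := by
  ext i
  simp

lemma gcd_nsmul_of_isCoprime (n : ℕ) {u : Fin 2 → ℤ} (hu : IsCoprime (u 0) (u 1)) :
    ((n • u) 0).gcd ((n • u) 1) = n := by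
  simp [Int.gcd_mul_left, Int.isCoprime_iff_gcd_eq_one.mp hu]

lemma exists_nsmul_eq_of_ne_zero {w : Fin 2 → ℤ} (hw : w ≠ 0) :
    ∃ (n : ℕ) (u : Fin 2 → ℤ), n ≠ 0 ∧ IsCoprime (u 0) (u 1) ∧ n • u = w := by
  have hgcd : (w 0).gcd (w 1) ≠ 0 := by
    rw [Ne, Int.gcd_eq_zero_iff]
    exact fun h => hw (by ext i; fin_cases i <;> simp [h])
  refine ⟨(w 0).gcd (w 1), ![w 0 / (w 0).gcd (w 1), w 1 / (w 0).gcd (w 1)], hgcd, ?_, ?_⟩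
  · exact Int.isCoprime_iff_gcd_eq_one.mpr
      (Int.gcd_ediv_gcd_ediv_gcd (Nat.pos_of_ne_zero hgcd))
  · ext i
    fin_cases i
    · simpa using Int.mul_ediv_cancel' (Int.gcd_dvd_left (w 0) (w 1))
    · simpa using Int.mul_ediv_cancel' (Int.gcd_dvd_right (w 0) (w 1))

lemma isUnit_of_addOrderOf_nsmul {M : Type*} [AddMonoid M] {N n : ℕ} [NeZero N] (hn : n ≠ 0)
    {x : M} (hx : addOrderOf x = N) (hnx : addOrderOf (n • x) = N) : IsUnit (n : ZMod N) := by
  rw [addOrderOf_nsmul' x hn, hx] at hnx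
  rw [ZMod.isUnit_iff_coprime, Nat.coprime_comm]
  have hmul := Nat.div_mul_cancel (Nat.gcd_dvd_left N n)
  rw [hnx] at hmul
  exact (mul_eq_left₀ (NeZero.ne N)).mp hmul

/-- The triples `(δ, n, u)` with `n ≡ δ` a positive integer and `u ≡ δ⁻¹ v` a primitive vector,
which parametrise the nonzero vectors `n u` in the class of `v` by their gcd `n` and primitive part
`u`. -/
abbrev GcdIndex {N : ℕ} (v : Lat N) : Type :=
  Σ δ : (ZMod N)ˣ, {n : ℕ // 1 ≤ n ∧ (n : ZMod N) = δ} ×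
    {u : Fin 2 → ℤ // (fun i => (u i : ZMod N)) = (v.scale δ⁻¹).val ∧ IsCoprime (u 0) (u 1)}

lemma nsmul_mem_class {N : ℕ} {v : Lat N} (p : GcdIndex v) :
    (fun i => (((p.2.1.1 • p.2.2.1) i : ℤ) : ZMod N)) = v.val ∧ p.2.1.1 • p.2.2.1 ≠ 0 := by
  obtain ⟨δ, ⟨n, hn, hnδ⟩, u, hu, hcop⟩ := p
  constructor
  · calc _ = (n : ZMod N) • fun i => (u i : ZMod N) := by
          rw [Nat.cast_smul_eq_nsmul]; exact intCast_nsmul n u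
      _ = δ • (δ⁻¹ • v.val) := by rw [hnδ, hu]; rfl
      _ = v.val := smul_inv_smul δ v.val
  · intro h
    have hgcd := gcd_nsmul_of_isCoprime n hcop
    rw [h, Pi.zero_apply, Pi.zero_apply, Int.gcd_self, Int.natAbs_zero] at hgcd
    omega

lemma bijective_nsmul_gcdIndex {N : ℕ} [NeZero N] (v : Lat N) :
    Function.Bijective fun p : GcdIndex v =>
      (⟨p.2.1.1 • p.2.2.1, nsmul_mem_class p⟩ :
        {w : Fin 2 → ℤ // (fun i => (w i : ZMod N)) = v.val ∧ w ≠ 0}) := by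
  constructor
  · rintro ⟨δ, ⟨n, hn, hnδ⟩, u, hu, hcop⟩ ⟨δ', ⟨n', hn', hnδ'⟩, u', hu', hcop'⟩ h
    have hvec : n • u = n' • u' := congrArg Subtype.val h
    obtain rfl : n = n' := by
      rw [← gcd_nsmul_of_isCoprime n hcop, hvec, gcd_nsmul_of_isCoprime n' hcop']
    obtain rfl : δ = δ' := Units.ext (hnδ.symm.trans hnδ')
    obtain rfl : u = u' := nsmul_right_injective (by omega) hvec
    rfl
  · rintro ⟨w, hwv, hw⟩
    obtain ⟨n, u, hn, hcop, rfl⟩ := exists_nsmul_eq_of_ne_zero hw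
    rw [intCast_nsmul] at hwv
    obtain ⟨δ, hδ⟩ := isUnit_of_addOrderOf_nsmul hn (addOrderOf_of_isCoprime N hcop)
      (hwv ▸ v.order_eq)
    refine ⟨⟨δ, ⟨n, by omega, hδ.symm⟩, u, ?_, hcop⟩, rfl⟩
    change _ = δ⁻¹ • v.val
    rw [eq_inv_smul_iff, ← hwv, ← Nat.cast_smul_eq_nsmul (ZMod N), ← hδ, Units.smul_def]

lemma levelG_eq_sum_primG {k N : ℕ} (hk : k ≠ 0) [NeZero N] (v : Lat N) (τ : ℍ) {s : ℂ}
    (hs : 2 < ((k : ℂ) + 2 * s).re) :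
    levelG k v τ s = ∑ δ : (ZMod N)ˣ, zetaPlus δ (k + 2 * s) * primG k (v.scale δ⁻¹) τ s := by
  have hsum := summable_eisTerm hk τ hs
  have hfactor (p : GcdIndex v) : eisTerm k τ s (p.2.1.1 • p.2.2.1) =
      1 / (p.2.1.1 : ℂ) ^ ((k : ℂ) + 2 * s) * eisTerm k τ s p.2.2.1 :=
    eisTerm_nsmul k τ s (Nat.one_le_iff_ne_zero.mp p.2.1.2.1) _
  have hsigma : Summable fun p : GcdIndex v =>
      1 / (p.2.1.1 : ℂ) ^ ((k : ℂ) + 2 * s) * eisTerm k τ s p.2.2.1 := by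
    simp_rw [← hfactor]
    exact hsum.comp_injective (Subtype.val_injective.comp (bijective_nsmul_gcdIndex v).injective)
  have hfiber (δ : (ZMod N)ˣ) : zetaPlus δ (k + 2 * s) * primG k (v.scale δ⁻¹) τ s =
      ∑' p : {n : ℕ // 1 ≤ n ∧ (n : ZMod N) = δ} × {u : Fin 2 → ℤ //
          (fun i => (u i : ZMod N)) = (v.scale δ⁻¹).val ∧ IsCoprime (u 0) (u 1)},
        1 / (p.1.1 : ℂ) ^ ((k : ℂ) + 2 * s) * eisTerm k τ s p.2.1 :=
    tsum_mul_tsum_of_summable_norm (summable_zetaPlus δ (by linarith)).norm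
      (hsum.comp_injective Subtype.val_injective).norm
  rw [levelG, ← (Equiv.ofBijective _ (bijective_nsmul_gcdIndex v)).tsum_eq]
  simp_rw [Equiv.ofBijective_apply, hfactor, hfiber]
  rw [hsigma.tsum_sigma, tsum_fintype]

lemma Lat.scale_mul {N : ℕ} (δ ε : (ZMod N)ˣ) (v : Lat N) :
    v.scale (δ * ε) = (v.scale ε).scale δ :=
  Lat.ext (mul_smul δ ε v.val)

lemma Lat.scale_one {N : ℕ} (v : Lat N) : v.scale 1 = v :=
  Lat.ext (one_smul _ v.val)

lemma primG_eq_sum_levelG {k N : ℕ} (hk : k ≠ 0) [NeZero N] (v : Lat N) (τ : ℍ) {s : ℂ}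
    (hs : 2 < ((k : ℂ) + 2 * s).re) :
    primG k v τ s = ∑ δ : (ZMod N)ˣ, zetaPlusMu δ (k + 2 * s) * levelG k (v.scale δ⁻¹) τ s := by
  classical
  have hlevel (δ : (ZMod N)ˣ) : levelG k (v.scale δ⁻¹) τ s =
      ∑ η : (ZMod N)ˣ, zetaPlus (δ⁻¹ * η) (k + 2 * s) * primG k (v.scale η⁻¹) τ s := by
    rw [levelG_eq_sum_primG hk _ τ hs, ← Equiv.sum_comp (Equiv.mulLeft δ⁻¹)]
    refine Finset.sum_congr rfl fun η _ => ?_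
    rw [Equiv.coe_mulLeft, ← Lat.scale_mul, _root_.mul_inv_rev, inv_inv, mul_inv_cancel_right]
  symm
  calc ∑ δ : (ZMod N)ˣ, zetaPlusMu δ (k + 2 * s) * levelG k (v.scale δ⁻¹) τ s
    _ = ∑ η : (ZMod N)ˣ, (∑ δ : (ZMod N)ˣ, zetaPlusMu δ (k + 2 * s) *
          zetaPlus (δ⁻¹ * η) (k + 2 * s)) * primG k (v.scale η⁻¹) τ s := by
      simp_rw [hlevel, Finset.mul_sum, Finset.sum_mul, mul_assoc]
      exact Finset.sum_comm
    _ = ∑ η : (ZMod N)ˣ, (if η = 1 then 1 else 0) * primG k (v.scale η⁻¹) τ s := by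
      simp_rw [sum_zetaPlusMu_mul_zetaPlus _ (show 1 < ((k : ℂ) + 2 * s).re by linarith)]
    _ = primG k v τ s := by
      simp only [ite_mul, one_mul, zero_mul, Finset.sum_ite_eq', Finset.mem_univ, if_true, inv_one,
        Lat.scale_one]

end GcdDecomposition

/-! ### Cusps, orbits and signs -/

section Representatives

variable {N : ℕ} {𝒢 : Subgroup SL(2, ℤ)}

instance : InvolutiveNeg (Lat N) where
  neg_neg v := Lat.ext (neg_neg v.val)

lemma Lat.act_one (v : Lat N) : v.act 1 = v := v.act_of_mem (one_mem _)

lemma Lat.act_neg (v : Lat N) (γ : SL(2, ℤ)) : v.act (-γ) = -(v.act γ) := by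
  have hredN : redN N (-γ) = -redN N γ := by
    ext i j
    simp [redN]
  exact Lat.ext (by rw [Lat.act_val, hredN, vecMul_neg, Lat.neg_val, Lat.act_val])

lemma Lat.neg_eq_self_iff [NeZero N] (v : Lat N) : -v = v ↔ N ≤ 2 := by
  calc -v = v ↔ 2 • v.val = 0 := by
        rw [two_nsmul, Lat.ext_iff, Lat.neg_val, neg_eq_iff_add_eq_zero]
    _ ↔ N ∣ 2 := by rw [← addOrderOf_dvd_iff_nsmul_eq_zero, v.order_eq]
    _ ↔ N ≤ 2 := by
      refine ⟨Nat.le_of_dvd two_pos, fun hN => ?_⟩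
      have := NeZero.pos N
      interval_cases N <;> decide

lemma Lat.scale_injective (δ : (ZMod N)ˣ) : Function.Injective (Lat.scale (N := N) δ) :=
  fun _ _ h => Lat.ext (smul_left_cancel δ (congrArg Lat.val h))

lemma mem_latOrbit_self (𝒢 : Subgroup SL(2, ℤ)) (v : Lat N) : v ∈ latOrbit 𝒢 v :=
  ⟨1, one_mem _, v.act_one.symm⟩

lemma latOrbit_eq_of_mem {v w : Lat N} (hw : w ∈ latOrbit 𝒢 v) : latOrbit 𝒢 w = latOrbit 𝒢 v := by
  obtain ⟨γ, hγ, rfl⟩ := hw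
  ext u
  constructor
  · rintro ⟨γ', hγ', rfl⟩
    exact ⟨γ * γ', mul_mem hγ hγ', (v.act_mul γ γ').symm⟩
  · rintro ⟨γ', hγ', rfl⟩
    exact ⟨γ⁻¹ * γ', mul_mem (inv_mem hγ) hγ', by rw [← Lat.act_mul, mul_inv_cancel_left]⟩

lemma image_scale_latOrbit (δ : (ZMod N)ˣ) (v : Lat N) :
    Lat.scale δ '' latOrbit 𝒢 v = latOrbit 𝒢 (v.scale δ) := by
  ext u
  constructor
  · rintro ⟨_, ⟨γ, hγ, rfl⟩, rfl⟩
    exact ⟨γ, hγ, Lat.scale_act δ v γ⟩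
  · rintro ⟨γ, hγ, rfl⟩
    exact ⟨_, ⟨γ, hγ, rfl⟩, Lat.scale_act δ v γ⟩

lemma isRegularOrbit_iff {v : Lat N} :
    IsRegularOrbit (latOrbit 𝒢 v) ↔ ∀ γ ∈ 𝒢, v.act γ ≠ -v := by
  constructor
  · intro hv γ hγ h
    exact hv v (mem_latOrbit_self 𝒢 v) ⟨γ, hγ, h.symm⟩
  · rintro hv _ ⟨γ, hγ, rfl⟩ ⟨γ', hγ', h⟩
    refine hv (γ' * γ⁻¹) (mul_mem hγ' (inv_mem hγ)) ?_
    rw [Lat.act_mul, ← h, Lat.neg_act, ← Lat.act_mul, mul_inv_cancel, Lat.act_one]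

lemma isRegularOrbit_neg {v : Lat N} :
    IsRegularOrbit (latOrbit 𝒢 (-v)) ↔ IsRegularOrbit (latOrbit 𝒢 v) := by
  simp_rw [isRegularOrbit_iff, Lat.neg_act, Ne, neg_inj]

lemma isRegularOrbit_scale (δ : (ZMod N)ˣ) {v : Lat N} :
    IsRegularOrbit (latOrbit 𝒢 (v.scale δ)) ↔ IsRegularOrbit (latOrbit 𝒢 v) := by
  simp_rw [isRegularOrbit_iff, ← Lat.scale_act, ← Lat.scale_neg, (Lat.scale_injective δ).ne_iff]

variable (A : SignReps N)

lemma SignReps.lift_mem (θ : LatPM N) : A.lift θ ∈ A.carrier :=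
  (A.existsUnique θ).choose_spec.1.1

lemma SignReps.mk_lift (θ : LatPM N) : LatPM.mk (A.lift θ) = θ :=
  (A.existsUnique θ).choose_spec.1.2

lemma SignReps.lift_mk {v : Lat N} (hv : v ∈ A.carrier) : A.lift (LatPM.mk v) = v :=
  (A.existsUnique (LatPM.mk v)).unique ⟨A.lift_mem _, A.mk_lift _⟩ ⟨hv, rfl⟩

lemma SignReps.lift_injective : Function.Injective A.lift :=
  Function.LeftInverse.injective A.mk_lift

lemma SignReps.lift_mk_eq_or (v : Lat N) :
    A.lift (LatPM.mk v) = v ∨ A.lift (LatPM.mk v) = -v :=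
  LatPM.mk_eq_iff.mp (A.mk_lift (LatPM.mk v)).symm

lemma SignReps.neg_mem_iff [NeZero N] {v : Lat N} (hv : v ∈ A.carrier) :
    -v ∈ A.carrier ↔ N ≤ 2 := by
  rw [← Lat.neg_eq_self_iff v]
  refine ⟨fun hneg => ?_, fun h => h.symm ▸ hv⟩
  rw [← A.lift_mk hneg, LatPM.mk_eq_iff.mpr (Or.inr (neg_neg v).symm), A.lift_mk hv]

end Representatives

section CuspsAndClasses

variable {N : ℕ} {𝒢 : Subgroup SL(2, ℤ)}

lemma Cusp.mk_surjective (𝒢 : Subgroup SL(2, ℤ)) : Function.Surjective (Cusp.mk 𝒢) :=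
  Quotient.mk_surjective

lemma Cusp.mk_eq_iff {p q : OnePoint ℚ} : Cusp.mk 𝒢 p = Cusp.mk 𝒢 q ↔ ∃ γ ∈ 𝒢, γ • q = p := by
  constructor
  · intro h
    obtain ⟨⟨γ, hγ⟩, hq⟩ := Quotient.exact h
    exact ⟨γ, hγ, hq⟩
  · rintro ⟨γ, hγ, rfl⟩
    exact Cusp.mk_smul hγ q

lemma phi_mk_smul_infty (N : ℕ) (g : SL(2, ℤ)) :
    phi N (Cusp.mk _ (g • (∞ : OnePoint ℚ))) = LatPM.mk ((Lat.base N).act g⁻¹) :=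
  phiPoint_smul_infty N g

lemma cuspMap_surjective (h : CongruenceSubgroup.Gamma N ≤ 𝒢) :
    Function.Surjective (cuspMap h) := fun x => by
  obtain ⟨p, rfl⟩ := Cusp.mk_surjective 𝒢 x
  exact ⟨Cusp.mk _ p, rfl⟩

lemma cuspMap_eq_mk_iff (h : CongruenceSubgroup.Gamma N ≤ 𝒢)
    (y : Cusp (CongruenceSubgroup.Gamma N)) (σ : SL(2, ℤ)) :
    cuspMap h y = Cusp.mk 𝒢 (σ • (∞ : OnePoint ℚ)) ↔
      ∃ γ ∈ 𝒢, phi N y = LatPM.mk ((Lat.base N).act (σ⁻¹ * γ)) := by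
  have hphi (γ : SL(2, ℤ)) : phi N (Cusp.mk _ (γ⁻¹ • σ • (∞ : OnePoint ℚ))) =
      LatPM.mk ((Lat.base N).act (σ⁻¹ * γ)) := by
    rw [← mul_smul, phi_mk_smul_infty, _root_.mul_inv_rev, inv_inv]
  obtain ⟨p, rfl⟩ := Cusp.mk_surjective _ y
  change Cusp.mk 𝒢 p = _ ↔ _
  constructor
  · intro hp
    obtain ⟨γ, hγ, rfl⟩ := Cusp.mk_eq_iff.mp hp
    exact ⟨γ⁻¹, inv_mem hγ, by rw [← hphi, inv_inv]⟩
  · rintro ⟨γ, hγ, hp⟩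
    obtain ⟨γ', hγ', rfl⟩ := Cusp.mk_eq_iff.mp (phi_injective N (hp.trans (hphi γ).symm))
    rw [Cusp.mk_smul (h hγ'), Cusp.mk_smul (inv_mem hγ)]

lemma LatPM.scale_inv_scale (δ : (ZMod N)ˣ) (θ : LatPM N) : (θ.scale δ).scale δ⁻¹ = θ := by
  induction θ using Quotient.inductionOn with
  | h v =>
    change LatPM.mk ((v.scale δ).scale δ⁻¹) = LatPM.mk v
    rw [← Lat.scale_mul, inv_mul_cancel, Lat.scale_one]

variable [NeZero N]

/-- The action of `(ℤ/N)ˣ` on the cusps of `Γ(N)` which corresponds under `φ_N` to scalar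
multiplication on `Λ_N^±`. -/
noncomputable def scaleCusp (δ : (ZMod N)ˣ) (y : Cusp (CongruenceSubgroup.Gamma N)) :
    Cusp (CongruenceSubgroup.Gamma N) :=
  (phiEquiv N).symm ((phi N y).scale δ)

lemma phi_scaleCusp (δ : (ZMod N)ˣ) (y : Cusp (CongruenceSubgroup.Gamma N)) :
    phi N (scaleCusp δ y) = (phi N y).scale δ :=
  (phiEquiv N).apply_symm_apply _

lemma scaleCusp_inv_scaleCusp (δ : (ZMod N)ˣ) (y : Cusp (CongruenceSubgroup.Gamma N)) :
    scaleCusp δ⁻¹ (scaleCusp δ y) = y :=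
  phi_injective N (by rw [phi_scaleCusp, phi_scaleCusp, LatPM.scale_inv_scale])

lemma cuspMap_scaleCusp (h : CongruenceSubgroup.Gamma N ≤ 𝒢) (δ : (ZMod N)ˣ)
    (y : Cusp (CongruenceSubgroup.Gamma N)) :
    cuspMap h (scaleCusp δ y) = unitAct h δ (cuspMap h y) := by
  obtain ⟨p, rfl⟩ := Cusp.mk_surjective _ y
  rfl

lemma unitAct_inv_unitAct (h : CongruenceSubgroup.Gamma N ≤ 𝒢) (δ : (ZMod N)ˣ) (x : Cusp 𝒢) :
    unitAct h δ⁻¹ (unitAct h δ x) = x := by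
  obtain ⟨y, rfl⟩ := cuspMap_surjective h x
  rw [← cuspMap_scaleCusp, ← cuspMap_scaleCusp, scaleCusp_inv_scaleCusp]

lemma bijOn_scaleCusp (h : CongruenceSubgroup.Gamma N ≤ 𝒢) (δ : (ZMod N)ˣ) (x : Cusp 𝒢) :
    Set.BijOn (scaleCusp δ) (cuspOrbit h x) (cuspOrbit h (unitAct h δ x)) := by
  refine Set.InvOn.bijOn (f' := scaleCusp δ⁻¹)
    ⟨fun y _ => scaleCusp_inv_scaleCusp δ y, fun y _ => ?_⟩ (fun y hy => ?_) fun y hy => ?_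
  · simpa only [inv_inv] using scaleCusp_inv_scaleCusp δ⁻¹ y
  · exact (cuspMap_scaleCusp h δ y).trans (congrArg _ hy)
  · exact (cuspMap_scaleCusp h δ⁻¹ y).trans ((congrArg _ hy).trans (unitAct_inv_unitAct h δ x))

end CuspsAndClasses

section RegularCusps

variable {N : ℕ} {𝒢 : Subgroup SL(2, ℤ)}

lemma upperRightHom_eq_toGL (b : ℤ) :
    GeneralLinearGroup.upperRightHom b = SpecialLinearGroup.toGL (ModularGroup.T ^ b) := by
  apply Units.ext
  rw [SpecialLinearGroup.coe_GL_coe_matrix, ModularGroup.coe_T_zpow]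
  rfl

lemma toGL_neg (g : SL(2, ℤ)) :
    (SpecialLinearGroup.toGL (-g) : GL (Fin 2) ℤ) = -SpecialLinearGroup.toGL g := by
  apply Units.ext
  rw [Units.val_neg, SpecialLinearGroup.coe_GL_coe_matrix, SpecialLinearGroup.coe_GL_coe_matrix,
    SpecialLinearGroup.coe_neg]

lemma toGL_mem_map_conj_iff {σ g : SL(2, ℤ)} :
    SpecialLinearGroup.toGL g ∈ (𝒢.map (MulAut.conj σ⁻¹).toMonoidHom).map
      (SpecialLinearGroup.toGL : SL(2, ℤ) →* GL (Fin 2) ℤ) ↔ σ * g * σ⁻¹ ∈ 𝒢 := by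
  rw [Subgroup.mem_map_iff_mem SpecialLinearGroup.toGL_injective, Subgroup.mem_map_equiv,
    ← MulAut.inv_def, ← map_inv, inv_inv, MulAut.conj_apply]

lemma isRegularCusp_iff {x : Cusp 𝒢} :
    IsRegularCusp x ↔ ∀ σ : SL(2, ℤ), Cusp.mk 𝒢 (σ • (∞ : OnePoint ℚ)) = x → ∀ b : ℤ,
      σ * -(ModularGroup.T ^ b) * σ⁻¹ ∈ 𝒢 → σ * ModularGroup.T ^ b * σ⁻¹ ∈ 𝒢 := by
  refine forall₂_congr fun σ _ => ?_
  rw [Subgroup.IsRegularAtInfty, SetLike.ext_iff]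
  refine forall_congr' fun b => ?_
  rw [Subgroup.periods, Subgroup.mem_strictPeriods_iff, Subgroup.mem_strictPeriods_iff,
    Subgroup.mem_adjoinNegOne_iff, upperRightHom_eq_toGL, ← toGL_neg, toGL_mem_map_conj_iff,
    toGL_mem_map_conj_iff]
  tauto

lemma base_act_T_zpow (N : ℕ) (b : ℤ) : (Lat.base N).act (ModularGroup.T ^ b) = Lat.base N := by
  apply Lat.ext
  rw [base_act_val]
  ext i
  fin_cases i <;> simp [Lat.base, Lat.ofPrim, ModularGroup.coe_T_zpow]

lemma exists_mul_T_zpow_mem_Gamma {m : SL(2, ℤ)} (hm : (Lat.base N).act m = Lat.base N) :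
    ∃ b : ℤ, m * ModularGroup.T ^ b ∈ CongruenceSubgroup.Gamma N := by
  have hval := congrArg Lat.val hm
  rw [base_act_val] at hval
  have hm10 : ((m 1 0 : ℤ) : ZMod N) = 0 := by
    simpa [Lat.base, Lat.ofPrim] using congrFun hval 0
  have hm11 : ((m 1 1 : ℤ) : ZMod N) = 1 := by
    simpa [Lat.base, Lat.ofPrim] using congrFun hval 1
  have hm00 : ((m 0 0 : ℤ) : ZMod N) = 1 := by
    have hdet := congrArg (Int.cast : ℤ → ZMod N) m.det_coe
    rw [det_fin_two] at hdet
    simpa [hm10, hm11] using hdet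
  refine ⟨-m 0 1, CongruenceSubgroup.Gamma_mem.mpr ?_⟩
  simp [Matrix.mul_apply, Fin.sum_univ_two, ModularGroup.coe_T_zpow, hm10, hm11, hm00]

lemma isRegularOrbit_base_act_iff (h : CongruenceSubgroup.Gamma N ≤ 𝒢) (σ : SL(2, ℤ)) :
    IsRegularOrbit (latOrbit 𝒢 ((Lat.base N).act σ⁻¹)) ↔
      ∀ b : ℤ, σ * -(ModularGroup.T ^ b) * σ⁻¹ ∉ 𝒢 := by
  rw [isRegularOrbit_iff]
  constructor
  · intro hreg b hb
    refine hreg _ hb ?_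
    rw [← Lat.act_mul, mul_assoc, inv_mul_cancel_left, Lat.act_mul, Lat.act_neg, base_act_T_zpow,
      Lat.neg_act]
  · intro hT γ hγ hneg
    have hfix : (Lat.base N).act (-(σ⁻¹ * γ * σ)) = Lat.base N := by
      rw [Lat.act_neg, Lat.act_mul, Lat.act_mul, hneg, Lat.neg_act, ← Lat.act_mul, inv_mul_cancel,
        Lat.act_one, neg_neg]
    obtain ⟨b, hb⟩ := exists_mul_T_zpow_mem_Gamma hfix
    have hconj := h ((CongruenceSubgroup.Gamma_normal N).conj_mem _ hb σ)
    refine hT b ?_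
    have hmul : σ * -(ModularGroup.T ^ b) * σ⁻¹ =
        γ⁻¹ * (σ * (-(σ⁻¹ * γ * σ) * ModularGroup.T ^ b) * σ⁻¹) := by
      simp [mul_assoc]
    rw [hmul]
    exact mul_mem (inv_mem hγ) hconj

lemma isRegularCusp_iff_of_neg_one_notMem (h1 : -1 ∉ 𝒢) {x : Cusp 𝒢} :
    IsRegularCusp x ↔ ∀ σ : SL(2, ℤ), Cusp.mk 𝒢 (σ • (∞ : OnePoint ℚ)) = x → ∀ b : ℤ,
      σ * -(ModularGroup.T ^ b) * σ⁻¹ ∉ 𝒢 := by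
  rw [isRegularCusp_iff]
  refine forall₃_congr fun σ _ b => ⟨fun hreg hb => h1 ?_, fun hb hmem => absurd hmem hb⟩
  simpa [mul_assoc] using mul_mem hb (inv_mem (hreg hb))

lemma isRegularOrbit_iff_of_mk_eq {v w : Lat N} {γ : SL(2, ℤ)} (hγ : γ ∈ 𝒢)
    (hvw : LatPM.mk v = LatPM.mk (w.act γ)) :
    IsRegularOrbit (latOrbit 𝒢 w) ↔ IsRegularOrbit (latOrbit 𝒢 v) := by
  rw [← latOrbit_eq_of_mem ⟨γ, hγ, rfl⟩]
  rcases LatPM.mk_eq_iff.mp hvw with hw | hw <;> rw [hw]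
  exact isRegularOrbit_neg

lemma isRegularCusp_cuspMap_iff (h : CongruenceSubgroup.Gamma N ≤ 𝒢) (h1 : -1 ∉ 𝒢)
    {y : Cusp (CongruenceSubgroup.Gamma N)} {v : Lat N} (hv : phi N y = LatPM.mk v) :
    IsRegularCusp (cuspMap h y) ↔ IsRegularOrbit (latOrbit 𝒢 v) := by
  have horbit (σ : SL(2, ℤ)) (hσ : Cusp.mk 𝒢 (σ • (∞ : OnePoint ℚ)) = cuspMap h y) :
      IsRegularOrbit (latOrbit 𝒢 ((Lat.base N).act σ⁻¹)) ↔ IsRegularOrbit (latOrbit 𝒢 v) := by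
    obtain ⟨γ, hγ, hy⟩ := (cuspMap_eq_mk_iff h y σ).mp hσ.symm
    exact isRegularOrbit_iff_of_mk_eq hγ (by rw [← hv, hy, Lat.act_mul])
  simp_rw [isRegularCusp_iff_of_neg_one_notMem h1, ← isRegularOrbit_base_act_iff h]
  refine ⟨fun hreg => ?_, fun hreg σ hσ => (horbit σ hσ).mpr hreg⟩
  obtain ⟨p, hp⟩ := Cusp.mk_surjective 𝒢 (cuspMap h y)
  obtain ⟨σ, rfl⟩ := exists_smul_infty p
  exact (horbit σ hp).mp (hreg σ hp)

lemma isRegularCusp_unitAct [NeZero N] (h : CongruenceSubgroup.Gamma N ≤ 𝒢) (h1 : -1 ∉ 𝒢)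
    {x : Cusp 𝒢} (hx : IsRegularCusp x) (δ : (ZMod N)ˣ) : IsRegularCusp (unitAct h δ x) := by
  obtain ⟨y, rfl⟩ := cuspMap_surjective h x
  obtain ⟨v, hv⟩ := Quotient.exists_rep (phi N y)
  have hscale : phi N (scaleCusp δ y) = LatPM.mk (v.scale δ) := by
    rw [phi_scaleCusp, ← hv]
    rfl
  rw [← cuspMap_scaleCusp, isRegularCusp_cuspMap_iff h h1 hscale, isRegularOrbit_scale]
  exact (isRegularCusp_cuspMap_iff h h1 hv.symm).mp hx

end RegularCusps

section CuspSigns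

variable {N : ℕ} {𝒢 : Subgroup SL(2, ℤ)} {A : SignReps N} {σ : ScalingChoice 𝒢}

lemma isRegularOrbit_orbitOfCusp (h : CongruenceSubgroup.Gamma N ≤ 𝒢) (h1 : -1 ∉ 𝒢)
    {x : Cusp 𝒢} (hx : IsRegularCusp x) : IsRegularOrbit (orbitOfCusp A σ x) := by
  have hmat : cuspMap h (Cusp.mk _ (σ.mat x • ∞)) = x := σ.mk_mat x
  exact (isRegularCusp_cuspMap_iff h h1 (A.mk_lift _).symm).mp (by rwa [hmat])

lemma orbitOfCusp_subset (h : CongruenceSubgroup.Gamma N ≤ 𝒢) (h1 : -1 ∉ 𝒢)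
    (hadm : A.IsAdmissible 𝒢) {x : Cusp 𝒢} (hx : IsRegularCusp x) :
    orbitOfCusp A σ x ⊆ A.carrier :=
  hadm _ (isRegularOrbit_orbitOfCusp h h1 hx) ⟨_, mem_latOrbit_self 𝒢 _, A.lift_mem _⟩

lemma exists_mem_orbitOfCusp_mk_eq_phi (h : CongruenceSubgroup.Gamma N ≤ 𝒢) {x : Cusp 𝒢}
    {y : Cusp (CongruenceSubgroup.Gamma N)} (hy : y ∈ cuspOrbit h x) :
    ∃ v ∈ orbitOfCusp A σ x, LatPM.mk v = phi N y := by
  obtain ⟨γ, hγ, hphi⟩ := (cuspMap_eq_mk_iff h y (σ.mat x)).mp (hy.trans (σ.mk_mat x).symm)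
  refine ⟨_, ⟨γ, hγ, rfl⟩, ?_⟩
  calc LatPM.mk ((A.lift (phi N (Cusp.mk _ (σ.mat x • ∞)))).act γ)
    _ = (LatPM.mk (A.lift (phi N (Cusp.mk _ (σ.mat x • ∞))))).act γ := rfl
    _ = (LatPM.mk ((Lat.base N).act (σ.mat x)⁻¹)).act γ := by rw [A.mk_lift, phi_mk_smul_infty]
    _ = phi N y := by rw [hphi, Lat.act_mul]; rfl

lemma latOrbit_lift_phi (h : CongruenceSubgroup.Gamma N ≤ 𝒢) (h1 : -1 ∉ 𝒢)
    (hadm : A.IsAdmissible 𝒢) {x : Cusp 𝒢} (hx : IsRegularCusp x)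
    {y : Cusp (CongruenceSubgroup.Gamma N)} (hy : y ∈ cuspOrbit h x) :
    latOrbit 𝒢 (A.lift (phi N y)) = orbitOfCusp A σ x := by
  obtain ⟨v, hv, hphi⟩ := exists_mem_orbitOfCusp_mk_eq_phi (A := A) (σ := σ) h hy
  rw [← hphi, A.lift_mk (orbitOfCusp_subset h h1 hadm hx hv)]
  exact latOrbit_eq_of_mem hv

variable [NeZero N]

lemma lift_phi_scaleCusp_eq_or (A : SignReps N) (δ : (ZMod N)ˣ)
    (y : Cusp (CongruenceSubgroup.Gamma N)) :
    A.lift (phi N (scaleCusp δ y)) = (A.lift (phi N y)).scale δ ∨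
      A.lift (phi N (scaleCusp δ y)) = -(A.lift (phi N y)).scale δ := by
  have hphi : phi N (scaleCusp δ y) = LatPM.mk ((A.lift (phi N y)).scale δ) :=
    (phi_scaleCusp δ y).trans (congrArg (LatPM.scale δ) (A.mk_lift (phi N y)).symm)
  rw [hphi]
  exact A.lift_mk_eq_or _

lemma image_scale_orbitOfCusp_eq_iff (h : CongruenceSubgroup.Gamma N ≤ 𝒢) (h1 : -1 ∉ 𝒢)
    (hadm : A.IsAdmissible 𝒢) {x : Cusp 𝒢} (hx : IsRegularCusp x) (δ : (ZMod N)ˣ)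
    {y : Cusp (CongruenceSubgroup.Gamma N)} (hy : y ∈ cuspOrbit h x) :
    Lat.scale δ '' orbitOfCusp A σ x = orbitOfCusp A σ (unitAct h δ x) ↔
      A.lift (phi N (scaleCusp δ y)) = (A.lift (phi N y)).scale δ := by
  have hx' := isRegularCusp_unitAct h h1 hx δ
  have horbit := latOrbit_lift_phi (σ := σ) h h1 hadm hx' ((bijOn_scaleCusp h δ x).mapsTo hy)
  rw [← latOrbit_lift_phi h h1 hadm hx hy, image_scale_latOrbit, ← horbit]
  refine ⟨fun heq => ?_, fun heq => by rw [heq]⟩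
  refine (lift_phi_scaleCusp_eq_or A δ y).resolve_right fun hneg => ?_
  have hreg : IsRegularOrbit (latOrbit 𝒢 (A.lift (phi N (scaleCusp δ y)))) :=
    horbit ▸ isRegularOrbit_orbitOfCusp h h1 hx'
  exact hreg _ (heq ▸ mem_latOrbit_self 𝒢 _) (hneg ▸ mem_latOrbit_self 𝒢 _)

lemma apply_scale_lift_phi {k : ℕ} (h : CongruenceSubgroup.Gamma N ≤ 𝒢)
    (hodd : Odd k → -1 ∉ 𝒢 ∧ A.IsAdmissible 𝒢) {x : Cusp 𝒢} (hx : Odd k → IsRegularCusp x)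
    {g : Lat N → ℂ} (hg : ∀ v, g (-v) = (-1) ^ k * g v) (δ : (ZMod N)ˣ)
    {y : Cusp (CongruenceSubgroup.Gamma N)} (hy : y ∈ cuspOrbit h x) :
    g ((A.lift (phi N y)).scale δ⁻¹) =
      cuspSign h A σ x δ ^ k * g (A.lift (phi N (scaleCusp δ⁻¹ y))) := by
  rcases Nat.even_or_odd k with hk | hk
  · have hsign : cuspSign h A σ x δ ^ k = 1 := by
      rw [cuspSign]
      split_ifs <;> simp only [one_pow, hk.neg_one_pow]
    rw [hsign, one_mul]
    rcases lift_phi_scaleCusp_eq_or A δ⁻¹ y with heq | hneg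
    · rw [heq]
    · rw [hneg, hg, hk.neg_one_pow, one_mul]
  · obtain ⟨h1, hadm⟩ := hodd hk
    have hiff := image_scale_orbitOfCusp_eq_iff (σ := σ) h h1 hadm (hx hk) δ⁻¹ hy
    rw [cuspSign]
    split_ifs with hsign
    · rw [hiff.mp hsign, one_pow, one_mul]
    · have hneg := (lift_phi_scaleCusp_eq_or A δ⁻¹ y).resolve_left (mt hiff.mpr hsign)
      rw [hneg, hg, ← mul_assoc, ← mul_pow, neg_one_mul, neg_neg, one_pow, one_mul]

lemma finsum_sum_scale {k : ℕ} (h : CongruenceSubgroup.Gamma N ≤ 𝒢)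
    (hodd : Odd k → -1 ∉ 𝒢 ∧ A.IsAdmissible 𝒢) {x : Cusp 𝒢} (hx : Odd k → IsRegularCusp x)
    {g : Lat N → ℂ} (hg : ∀ v, g (-v) = (-1) ^ k * g v) (c : (ZMod N)ˣ → ℂ) :
    ∑ᶠ y ∈ cuspOrbit h x, ∑ δ, c δ * g ((A.lift (phi N y)).scale δ⁻¹) =
      ∑ δ, cuspSign h A σ x δ ^ k * c δ *
        ∑ᶠ y ∈ cuspOrbit h (unitAct h δ⁻¹ x), g (A.lift (phi N y)) := by
  rw [finsum_mem_eq_finite_toFinset_sum _ (Set.toFinite (cuspOrbit h x)), Finset.sum_comm]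
  refine Finset.sum_congr rfl fun δ _ => ?_
  rw [← finsum_mem_eq_finite_toFinset_sum
    (fun y => c δ * g ((A.lift (phi N y)).scale δ⁻¹)) (Set.toFinite (cuspOrbit h x)),
    mul_finsum_mem]
  refine finsum_mem_eq_of_bijOn (scaleCusp δ⁻¹) (bijOn_scaleCusp h δ⁻¹ x) fun y hy => ?_
  rw [apply_scale_lift_phi h hodd hx hg δ hy]
  ring

end CuspSigns

/-! ### Cosets and coprime vectors -/

section BottomRows

/-- The bottom row of a matrix. -/
def botRow (m : SL(2, ℤ)) : Fin 2 → ℤ := fun i => m 1 i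

lemma isCoprime_botRow (m : SL(2, ℤ)) : IsCoprime (botRow m 0) (botRow m 1) :=
  m.isCoprime_row 1

lemma exists_botRow_eq {w : Fin 2 → ℤ} (hw : IsCoprime (w 0) (w 1)) : ∃ m, botRow m = w := by
  obtain ⟨m, hm0, hm1⟩ := hw.exists_SL2_row 1
  exact ⟨m, by ext i; fin_cases i; exacts [hm0, hm1]⟩

lemma botRow_ne_zero (m : SL(2, ℤ)) : botRow m ≠ 0 := fun h =>
  not_isCoprime_zero_zero (R := ℤ) (by simpa [h] using isCoprime_botRow m)

lemma botRow_neg (m : SL(2, ℤ)) : botRow (-m) = -botRow m := by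
  ext i
  simp [botRow]

lemma smul_infty_eq_infty_iff (g : SL(2, ℤ)) : g • (∞ : OnePoint ℚ) = ∞ ↔ g 1 0 = 0 := by
  rw [smul_point_def, OnePoint.smul_infty_eq_self_iff, SpecialLinearGroup.mapGL_coe_matrix,
    SpecialLinearGroup.map_apply_coe, RingHom.mapMatrix_apply, Matrix.map_apply]
  simp

lemma inv_smul_infty_eq_iff (m m' : SL(2, ℤ)) :
    m⁻¹ • (∞ : OnePoint ℚ) = m'⁻¹ • ∞ ↔ ∃ ε : ℤˣ, botRow m' = ε • botRow m := by
  have hentry : (m' * m⁻¹) 1 0 = m' 1 0 * m 1 1 - m' 1 1 * m 1 0 := by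
    simp [adjugate_fin_two, Matrix.mul_apply, sub_eq_add_neg]
  rw [eq_inv_smul_iff, ← mul_smul, smul_infty_eq_infty_iff, hentry, sub_eq_zero]
  constructor
  · intro hdet
    rcases coprime_unique (isCoprime_botRow m) (isCoprime_botRow m')
      (by simpa only [botRow, mul_comm] using hdet.symm) with ⟨h0, h1⟩ | ⟨h0, h1⟩
    · exact ⟨1, by ext i; fin_cases i <;> simp [h0, h1]⟩
    · exact ⟨-1, by ext i; fin_cases i <;> simp [h0, h1]⟩
  · rintro ⟨ε, hε⟩
    have h0 : m' 1 0 = ε * m 1 0 := congrFun hε 0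
    have h1 : m' 1 1 = ε * m 1 1 := congrFun hε 1
    rw [h0, h1]
    ring

lemma autFactor_ne_zero (m : SL(2, ℤ)) (τ : ℍ) : autFactor m τ ≠ 0 := by
  simpa [autFactor, ModularGroup.denom_apply] using
    denom_ne_zero (m : GL (Fin 2) ℝ) τ

lemma im_smul_mul_norm_autFactor_sq (m : SL(2, ℤ)) (τ : ℍ) :
    (m • τ).im * (‖autFactor m τ‖ * ‖autFactor m τ‖) = τ.im := by
  have hdenom : denom (m : GL (Fin 2) ℝ) τ = autFactor m τ := by simp [denom, autFactor]
  rw [ModularGroup.im_smul_eq_div_normSq, hdenom, Complex.normSq_eq_norm_sq, ← sq,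
    div_mul_cancel₀ _ (pow_ne_zero 2 (norm_ne_zero_iff.mpr (autFactor_ne_zero m τ)))]

lemma inv_autFactor_pow_mul_im_smul_cpow (k : ℕ) (m : SL(2, ℤ)) (τ : ℍ) (s : ℂ) :
    (autFactor m τ ^ k)⁻¹ * ((m • τ).im : ℂ) ^ s = eisTerm k τ s (botRow m) := by
  have hr : (‖autFactor m τ‖ : ℂ) ≠ 0 :=
    Complex.ofReal_ne_zero.mpr (norm_ne_zero_iff.mpr (autFactor_ne_zero m τ))
  have him : (τ.im : ℂ) ^ s = ((m • τ).im : ℂ) ^ s * (‖autFactor m τ‖ : ℂ) ^ (2 * s) := by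
    rw [← im_smul_mul_norm_autFactor_sq m τ, Complex.ofReal_mul,
      Complex.mul_cpow_ofReal_nonneg (m • τ).im_pos.le (by positivity), Complex.ofReal_mul,
      Complex.mul_cpow_ofReal_nonneg (norm_nonneg _) (norm_nonneg _), two_mul,
      Complex.cpow_add _ _ hr]
  have hcpow : (‖autFactor m τ‖ : ℂ) ^ (2 * s) ≠ 0 := by simp [Complex.cpow_eq_zero_iff, hr]
  change _ = (τ.im : ℂ) ^ s / (autFactor m τ ^ k * (‖autFactor m τ‖ : ℂ) ^ (2 * s))
  rw [him, mul_div_mul_right _ _ hcpow, div_eq_mul_inv, mul_comm]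

end BottomRows

section Cosets

variable {G X : Type*} [Group G] [MulAction G X] {p : X}

lemma out_inv_smul_injective :
    Function.Injective fun q : Quotient (QuotientGroup.rightRel (MulAction.stabilizer G p)) =>
      q.out⁻¹ • p := by
  intro q q' h
  rw [← q.out_eq, ← q'.out_eq, Quotient.eq, QuotientGroup.rightRel_apply,
    MulAction.mem_stabilizer_iff, mul_smul]
  exact (congrArg (q'.out • ·) h).trans (smul_inv_smul q'.out p)

lemma exists_out_inv_smul_eq (g : G) :
    ∃ q : Quotient (QuotientGroup.rightRel (MulAction.stabilizer G p)), q.out⁻¹ • p = g • p := by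
  refine ⟨Quotient.mk'' g⁻¹, ?_⟩
  have hrel := Quotient.mk_out (s := QuotientGroup.rightRel (MulAction.stabilizer G p)) g⁻¹
  rw [QuotientGroup.rightRel_apply, MulAction.mem_stabilizer_iff, mul_smul] at hrel
  exact inv_smul_eq_iff.mp hrel

end Cosets

section SignedRows

variable {𝒢 : Subgroup SL(2, ℤ)}

/-- The cosets `𝒢_{σ∞} \ 𝒢` over which `seriesE` is summed. -/
abbrev CosetIndex (𝒢 : Subgroup SL(2, ℤ)) (σ : SL(2, ℤ)) : Type :=
  Quotient (QuotientGroup.rightRel (MulAction.stabilizer 𝒢 (σ • (∞ : OnePoint ℚ))))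

/-- The primitive vector `± (0, 1) σ⁻¹ γ` attached to a coset, with representative `γ`, and a
sign. -/
noncomputable def signedRow (σ : SL(2, ℤ)) (q : CosetIndex 𝒢 σ × ℤˣ) : Fin 2 → ℤ :=
  q.2 • botRow (σ⁻¹ * (q.1.out : SL(2, ℤ)))

lemma mul_inv_smul_infty (σ : SL(2, ℤ)) (γ : 𝒢) :
    (σ⁻¹ * (γ : SL(2, ℤ)))⁻¹ • (∞ : OnePoint ℚ) = γ⁻¹ • σ • ∞ := by
  rw [_root_.mul_inv_rev, inv_inv, mul_smul]
  rfl

lemma signedRow_injective (𝒢 : Subgroup SL(2, ℤ)) (σ : SL(2, ℤ)) :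
    Function.Injective (signedRow (𝒢 := 𝒢) σ) := by
  rintro ⟨q, ε⟩ ⟨q', ε'⟩ h
  change ε • botRow _ = ε' • botRow _ at h
  obtain rfl : q = q' := by
    refine out_inv_smul_injective ?_
    beta_reduce
    rw [← mul_inv_smul_infty, ← mul_inv_smul_infty, inv_smul_infty_eq_iff]
    exact ⟨ε'⁻¹ * ε, by rw [mul_smul, h, inv_smul_smul]⟩
  rw [Units.smul_def, Units.smul_def] at h
  rw [Prod.mk.injEq, Units.ext_iff]
  exact ⟨rfl, smul_left_injective ℤ (botRow_ne_zero _) h⟩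

lemma exists_signedRow_eq {σ m : SL(2, ℤ)}
    (hm : Cusp.mk 𝒢 (m⁻¹ • (∞ : OnePoint ℚ)) = Cusp.mk 𝒢 (σ • (∞ : OnePoint ℚ))) :
    ∃ q, signedRow (𝒢 := 𝒢) σ q = botRow m := by
  obtain ⟨γ, hγ, hcusp⟩ := Cusp.mk_eq_iff.mp hm
  obtain ⟨q, hq⟩ := exists_out_inv_smul_eq (p := σ • (∞ : OnePoint ℚ)) (⟨γ, hγ⟩ : 𝒢)
  rw [← mul_inv_smul_infty] at hq
  obtain ⟨ε, hε⟩ := (inv_smul_infty_eq_iff _ _).mp (hq.trans hcusp)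
  exact ⟨(q, ε), hε.symm⟩

end SignedRows

section CuspVectors

variable {N : ℕ} {𝒢 : Subgroup SL(2, ℤ)}

/-- The primitive vectors whose class modulo `N` is the representative `λ̄_y` of a cusp `y` of
`Γ(N)` above `x`. They index the primitive parts of the terms of `seriesG`. -/
def cuspVecs (h : CongruenceSubgroup.Gamma N ≤ 𝒢) (A : SignReps N) (x : Cusp 𝒢) :
    Set (Fin 2 → ℤ) :=
  {w | (∃ y ∈ cuspOrbit h x, (fun i => (w i : ZMod N)) = (A.lift (phi N y)).val) ∧
    IsCoprime (w 0) (w 1)}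

lemma base_act_eq_iff (m : SL(2, ℤ)) (v : Lat N) :
    (Lat.base N).act m = v ↔ (fun i => (botRow m i : ZMod N)) = v.val := by
  rw [Lat.ext_iff, base_act_val]
  rfl

lemma botRow_mem_cuspVecs_iff (h : CongruenceSubgroup.Gamma N ≤ 𝒢) (A : SignReps N)
    (x : Cusp 𝒢) (m : SL(2, ℤ)) :
    botRow m ∈ cuspVecs h A x ↔
      Cusp.mk 𝒢 (m⁻¹ • (∞ : OnePoint ℚ)) = x ∧ (Lat.base N).act m ∈ A.carrier := by
  have hphi : phi N (Cusp.mk _ (m⁻¹ • (∞ : OnePoint ℚ))) = LatPM.mk ((Lat.base N).act m) := by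
    rw [phi_mk_smul_infty, inv_inv]
  simp only [cuspVecs, Set.mem_ofPred_eq, isCoprime_botRow, and_true, ← base_act_eq_iff]
  constructor
  · rintro ⟨y, hy, hact⟩
    rw [hact, A.mk_lift] at hphi
    obtain rfl := phi_injective N hphi
    exact ⟨hy, hact ▸ A.lift_mem _⟩
  · rintro ⟨hx, hmem⟩
    exact ⟨Cusp.mk _ (m⁻¹ • ∞), hx, by rw [hphi, A.lift_mk hmem]⟩

lemma finsum_primG_eq_tsum {k : ℕ} (hk : k ≠ 0) [NeZero N] (h : CongruenceSubgroup.Gamma N ≤ 𝒢)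
    (A : SignReps N) (x : Cusp 𝒢) (τ : ℍ) {s : ℂ} (hs : 2 < ((k : ℂ) + 2 * s).re) :
    ∑ᶠ y ∈ cuspOrbit h x, primG k (A.lift (phi N y)) τ s =
      ∑' w : cuspVecs h A x, eisTerm k τ s w := by
  set S := fun y => {w : Fin 2 → ℤ |
    (fun i => (w i : ZMod N)) = (A.lift (phi N y)).val ∧ IsCoprime (w 0) (w 1)}
  have hunion : cuspVecs h A x = ⋃ y ∈ (Set.toFinite (cuspOrbit h x)).toFinset, S y := by
    ext w
    simp only [cuspVecs, S, Set.mem_iUnion, Set.mem_ofPred_eq, Set.Finite.mem_toFinset, exists_prop,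
      ← and_assoc, exists_and_right]
  have hdisj : Set.Pairwise ((Set.toFinite (cuspOrbit h x)).toFinset : Set _)
      (Function.onFun Disjoint S) := fun y _ y' _ hne =>
    Set.disjoint_left.mpr fun w hw hw' => hne <|
      phi_injective N (A.lift_injective (Lat.ext (hw.1.symm.trans hw'.1)))
  rw [finsum_mem_eq_finite_toFinset_sum _ (Set.toFinite (cuspOrbit h x)), hunion,
    Summable.tsum_finset_bUnion_disjoint hdisj fun y _ => (summable_eisTerm hk τ hs).subtype _]
  rfl

lemma epsN_mul_ite_add_ite [NeZero N] {k : ℕ} (A : SignReps N) {v : Lat N}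
    (hodd : Odd k → v ∈ A.carrier ∧ ¬N ≤ 2) [DecidablePred (· ∈ A.carrier)] (a : ℂ) :
    epsN N * ((if v ∈ A.carrier then a else 0) + if -v ∈ A.carrier then (-1) ^ k * a else 0) =
      a := by
  rcases Nat.even_or_odd k with hk | hk
  · have hmem : v ∈ A.carrier ∨ -v ∈ A.carrier := by
      have hlift := A.lift_mem (LatPM.mk v)
      rcases A.lift_mk_eq_or v with heq | heq <;> rw [heq] at hlift <;> tauto
    have hboth : v ∈ A.carrier → (-v ∈ A.carrier ↔ N ≤ 2) := A.neg_mem_iff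
    have hboth' : -v ∈ A.carrier → (v ∈ A.carrier ↔ N ≤ 2) := fun hv => by
      simpa only [neg_neg] using A.neg_mem_iff hv
    rw [hk.neg_one_pow, one_mul, epsN]
    split_ifs <;> first | (exfalso; tauto) | ring
  · obtain ⟨hv, hN⟩ := hodd hk
    rw [if_pos hv, if_neg (mt (A.neg_mem_iff hv).mp hN), epsN, if_neg hN, one_mul, add_zero]

end CuspVectors

section SpectralSeries

variable {k N : ℕ} {𝒢 : Subgroup SL(2, ℤ)}

lemma base_act_mem_orbitOfCusp {A : SignReps N} {σ : ScalingChoice 𝒢} (hcomp : σ.IsCompatible A)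
    {x : Cusp 𝒢} (hx : IsRegularCusp x) {γ : SL(2, ℤ)} (hγ : γ ∈ 𝒢) :
    (Lat.base N).act ((σ.mat x)⁻¹ * γ) ∈ orbitOfCusp A σ x :=
  ⟨γ, hγ, by rw [hcomp x hx, Lat.act_mul]⟩

variable [NeZero N]

lemma epsN_mul_sum_indicator (h : CongruenceSubgroup.Gamma N ≤ 𝒢) (A : SignReps N) {x : Cusp 𝒢}
    {m : SL(2, ℤ)} (hm : Cusp.mk 𝒢 (m⁻¹ • (∞ : OnePoint ℚ)) = x)
    (hodd : Odd k → (Lat.base N).act m ∈ A.carrier ∧ ¬N ≤ 2) (τ : ℍ) (s : ℂ) :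
    epsN N * ∑ ε : ℤˣ, (cuspVecs h A x).indicator (eisTerm k τ s) (ε • botRow m) =
      eisTerm k τ s (botRow m) := by
  classical
  have hneg : Cusp.mk 𝒢 ((-m)⁻¹ • (∞ : OnePoint ℚ)) = x := by
    rw [← hm, (inv_smul_infty_eq_iff (-m) m).mpr ⟨-1, by simp [botRow_neg]⟩]
  rw [UnitsInt.univ, Finset.sum_pair (by decide), one_smul, Units.neg_smul, one_smul, ← botRow_neg]
  simp only [Set.indicator_apply, botRow_mem_cuspVecs_iff, hm, hneg, true_and, Lat.act_neg]
  rw [botRow_neg, eisTerm_neg, epsN_mul_ite_add_ite A hodd]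

lemma seriesE_eq_finsum_primG (hk : k ≠ 0) (h : CongruenceSubgroup.Gamma N ≤ 𝒢) {A : SignReps N}
    {σ : ScalingChoice 𝒢} (hodd : Odd k → -1 ∉ 𝒢 ∧ A.IsAdmissible 𝒢 ∧ σ.IsCompatible A)
    {x : Cusp 𝒢} (hx : Odd k → IsRegularCusp x) (τ : ℍ) {s : ℂ}
    (hs : 2 < ((k : ℂ) + 2 * s).re) :
    seriesE k 𝒢 (σ.mat x) τ s =
      epsN N * ∑ᶠ y ∈ cuspOrbit h x, primG k (A.lift (phi N y)) τ s := by
  have hsupp : Function.support ((cuspVecs h A x).indicator (eisTerm k τ s)) ⊆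
      Set.range (signedRow (𝒢 := 𝒢) (σ.mat x)) := by
    refine Set.support_indicator_subset.trans fun w hw => ?_
    obtain ⟨m, rfl⟩ := exists_botRow_eq hw.2
    exact exists_signedRow_eq
      (((botRow_mem_cuspVecs_iff h A x m).mp hw).1.trans (σ.mk_mat x).symm)
  have hsum : Summable fun q => (cuspVecs h A x).indicator (eisTerm k τ s)
      (signedRow (𝒢 := 𝒢) (σ.mat x) q) :=
    ((summable_eisTerm hk τ hs).indicator _).comp_injective (signedRow_injective 𝒢 (σ.mat x))
  rw [finsum_primG_eq_tsum hk h A x τ hs, tsum_subtype,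
    ← (signedRow_injective 𝒢 (σ.mat x)).tsum_eq hsupp, hsum.tsum_prod, ← tsum_mul_left, seriesE]
  refine tsum_congr fun q => ?_
  have hcusp : Cusp.mk 𝒢 (((σ.mat x)⁻¹ * (q.out : SL(2, ℤ)))⁻¹ • (∞ : OnePoint ℚ)) = x := by
    rw [mul_inv_smul_infty]
    exact (Cusp.mk_eq_iff.mpr ⟨_, inv_mem q.out.2, rfl⟩).trans (σ.mk_mat x)
  have hrow (hk : Odd k) :
      (Lat.base N).act ((σ.mat x)⁻¹ * (q.out : SL(2, ℤ))) ∈ A.carrier ∧ ¬N ≤ 2 := by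
    obtain ⟨h1, hadm, hcomp⟩ := hodd hk
    have hv := base_act_mem_orbitOfCusp hcomp (hx hk) q.out.2
    refine ⟨orbitOfCusp_subset h h1 hadm (hx hk) hv, fun hN => ?_⟩
    exact isRegularOrbit_orbitOfCusp h h1 (hx hk) _ hv
      (by rwa [(Lat.neg_eq_self_iff _).mpr hN])
  rw [tsum_fintype, inv_autFactor_pow_mul_im_smul_cpow, ← epsN_mul_sum_indicator h A hcusp hrow]
  rfl

end SpectralSeries

/-! ### Identities for the continued series -/

section Continuation

variable {k : ℕ}

lemma IsContinuation.continuation {f F : ℂ → ℂ} (hF : IsContinuation k f F) :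
    IsContinuation k f (continuation k f) :=
  Classical.epsilon_spec ⟨F, hF⟩

lemma IsContinuation.congr {f g F : ℂ → ℂ} (hF : IsContinuation k f F)
    (hfg : ∀ s : ℂ, 2 < ((k : ℂ) + 2 * s).re → f s = g s) : IsContinuation k g F :=
  ⟨hF.analytic, fun s hs => (hF.eq s hs).trans (hfg s hs)⟩

lemma IsContinuation.eqOn {f F G : ℂ → ℂ} (hF : IsContinuation k f F)
    (hG : IsContinuation k f G) : Set.EqOn F G {s | 1 < ((k : ℂ) + 2 * s).re} := by
  have hset (a : ℝ) : {s : ℂ | a < ((k : ℂ) + 2 * s).re} = {s | (a - k) / 2 < s.re} := by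
    ext s
    simp only [Set.mem_ofPred_eq, Complex.add_re, Complex.natCast_re, Complex.mul_re,
      Complex.re_ofNat, Complex.im_ofNat, zero_mul, sub_zero, div_lt_iff₀' (two_pos (α := ℝ)),
      sub_lt_iff_lt_add']
  have hmem : (2 : ℂ) ∈ {s : ℂ | 2 < ((k : ℂ) + 2 * s).re} := by
    rw [hset, Set.mem_ofPred_eq, Complex.re_ofNat]
    linarith [k.cast_nonneg (α := ℝ)]
  refine hF.analytic.eqOn_of_preconnected_of_eventuallyEq hG.analytic
    (by rw [hset]; exact (convex_halfSpace_re_gt _).isPreconnected)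
    (z₀ := 2) (one_lt_two.trans (Set.mem_ofPred_eq.mp hmem)) ?_
  have hopen : IsOpen {s : ℂ | 2 < ((k : ℂ) + 2 * s).re} := by rw [hset]; exact isOpen_lt_re _
  filter_upwards [hopen.mem_nhds hmem] with s hs
  rw [hF.eq s hs, hG.eq s hs]

lemma isContinuation_const_mul_sum {ι : Type*} [Fintype ι] (c : ℂ) (e : ι → ℂ)
    {z f F : ι → ℂ → ℂ}
    (hz : ∀ i, AnalyticOnNhd ℂ (fun s => z i (k + 2 * s)) {s | 1 < ((k : ℂ) + 2 * s).re})
    (hF : ∀ i, IsContinuation k (f i) (F i)) :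
    IsContinuation k (fun s => c * ∑ i, e i * z i (k + 2 * s) * f i s)
      (fun s => c * ∑ i, e i * z i (k + 2 * s) * F i s) where
  analytic := analyticOnNhd_const.mul <| Finset.analyticOnNhd_fun_sum _ fun i _ =>
    (analyticOnNhd_const.mul (hz i)).mul (hF i).analytic
  eq s hs := by simp only [fun i => (hF i).eq s hs]

end Continuation

section Identities

variable {k N : ℕ} [NeZero N] {𝒢 : Subgroup SL(2, ℤ)}

lemma isContinuation_unnormG (hk : k ≠ 0) (h : CongruenceSubgroup.Gamma N ≤ 𝒢) (A : SignReps N)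
    (x : Cusp 𝒢) (τ : ℍ) : IsContinuation k (seriesG k h A x τ) (unnormG k h A x τ) := by
  choose F hF using fun v : Lat N => exists_continuation_levelG hk v τ
  refine IsContinuation.continuation
    (F := fun s => ∑ y ∈ (Set.toFinite (cuspOrbit h x)).toFinset, F (A.lift (phi N y)) s)
    ⟨Finset.analyticOnNhd_fun_sum _ fun y _ => (hF _).analytic, fun s hs => ?_⟩
  rw [seriesG, finsum_mem_eq_finite_toFinset_sum _ (Set.toFinite (cuspOrbit h x))]
  exact Finset.sum_congr rfl fun y _ => (hF _).eq s hs

variable {A : SignReps N} {σ : ScalingChoice 𝒢} {x : Cusp 𝒢}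

lemma seriesE_eq_sum_seriesG (hk : k ≠ 0) (h : CongruenceSubgroup.Gamma N ≤ 𝒢)
    (hodd : Odd k → -1 ∉ 𝒢 ∧ A.IsAdmissible 𝒢 ∧ σ.IsCompatible A)
    (hx : Odd k → IsRegularCusp x) (τ : ℍ) {s : ℂ} (hs : 2 < ((k : ℂ) + 2 * s).re) :
    seriesE k 𝒢 (σ.mat x) τ s =
      epsN N * ∑ δ : (ZMod N)ˣ, cuspSign h A σ x δ ^ k * zetaPlusMu δ (k + 2 * s) *
        seriesG k h A (unitAct h δ⁻¹ x) τ s := by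
  rw [seriesE_eq_finsum_primG hk h hodd hx τ hs]
  simp_rw [primG_eq_sum_levelG hk _ τ hs]
  rw [finsum_sum_scale h (fun hk => ⟨(hodd hk).1, (hodd hk).2.1⟩) hx
    (σ := σ) (g := fun v => levelG k v τ s) (fun v => levelG_neg k v τ s)]
  rfl

lemma epsN_ne_zero (N : ℕ) : epsN N ≠ 0 := by
  rw [epsN]
  split_ifs <;> norm_num

lemma seriesG_eq_sum_seriesE (hk : k ≠ 0) (h : CongruenceSubgroup.Gamma N ≤ 𝒢)
    (hodd : Odd k → -1 ∉ 𝒢 ∧ A.IsAdmissible 𝒢 ∧ σ.IsCompatible A)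
    (hx : Odd k → IsRegularCusp x) (τ : ℍ) {s : ℂ} (hs : 2 < ((k : ℂ) + 2 * s).re) :
    seriesG k h A x τ s =
      (epsN N)⁻¹ * ∑ δ : (ZMod N)ˣ, cuspSign h A σ x δ ^ k * zetaPlus δ (k + 2 * s) *
        seriesE k 𝒢 (σ.mat (unitAct h δ⁻¹ x)) τ s := by
  rw [seriesG]
  simp_rw [levelG_eq_sum_primG hk _ τ hs]
  rw [finsum_sum_scale h (fun hk => ⟨(hodd hk).1, (hodd hk).2.1⟩) hx
    (σ := σ) (g := fun v => primG k v τ s) (fun v => primG_neg k v τ s), Finset.mul_sum]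
  refine Finset.sum_congr rfl fun δ _ => ?_
  rw [seriesE_eq_finsum_primG hk h hodd
    (fun hk => isRegularCusp_unitAct h (hodd hk).1 (hx hk) δ⁻¹) τ hs, mul_left_comm _ (epsN N),
    inv_mul_cancel_left₀ (epsN_ne_zero N)]

lemma isContinuation_seriesE (hk : k ≠ 0) (h : CongruenceSubgroup.Gamma N ≤ 𝒢)
    (hodd : Odd k → -1 ∉ 𝒢 ∧ A.IsAdmissible 𝒢 ∧ σ.IsCompatible A)
    (hx : Odd k → IsRegularCusp x) (τ : ℍ) :
    IsContinuation k (seriesE k 𝒢 (σ.mat x) τ) fun s =>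
      epsN N * ∑ δ : (ZMod N)ˣ, cuspSign h A σ x δ ^ k * zetaPlusMu δ (k + 2 * s) *
        unnormG k h A (unitAct h δ⁻¹ x) τ s :=
  (isContinuation_const_mul_sum _ _ (analyticOnNhd_zetaPlusMu k) fun δ =>
    isContinuation_unnormG hk h A (unitAct h δ⁻¹ x) τ).congr fun _ hs =>
      (seriesE_eq_sum_seriesG hk h hodd hx τ hs).symm

lemma isContinuation_spectralE (hk : k ≠ 0) (h : CongruenceSubgroup.Gamma N ≤ 𝒢)
    (hodd : Odd k → -1 ∉ 𝒢 ∧ A.IsAdmissible 𝒢 ∧ σ.IsCompatible A)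
    (hx : Odd k → IsRegularCusp x) (τ : ℍ) :
    IsContinuation k (seriesE k 𝒢 (σ.mat x) τ) (spectralE k σ x τ) :=
  (isContinuation_seriesE hk h hodd hx τ).continuation

lemma isContinuation_seriesG (hk : k ≠ 0) (h : CongruenceSubgroup.Gamma N ≤ 𝒢)
    (hodd : Odd k → -1 ∉ 𝒢 ∧ A.IsAdmissible 𝒢 ∧ σ.IsCompatible A)
    (hx : Odd k → IsRegularCusp x) (τ : ℍ) :
    IsContinuation k (seriesG k h A x τ) fun s =>
      (epsN N)⁻¹ * ∑ δ : (ZMod N)ˣ, cuspSign h A σ x δ ^ k * zetaPlus δ (k + 2 * s) *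
        spectralE k σ (unitAct h δ⁻¹ x) τ s :=
  (isContinuation_const_mul_sum _ _ (analyticOnNhd_zetaPlus k) fun δ =>
    isContinuation_spectralE hk h hodd
      (fun hk => isRegularCusp_unitAct h (hodd hk).1 (hx hk) δ⁻¹) τ).congr
    fun _ hs => (seriesG_eq_sum_seriesE hk h hodd hx τ hs).symm

end Identities

end CongEis

theorem proposition5p1_general (k : ℕ) (hk : k ≠ 0) (N : ℕ) [NeZero N]
    (𝒢 : Subgroup (Matrix.SpecialLinearGroup (Fin 2) ℤ))
    (h : CongruenceSubgroup.Gamma N ≤ 𝒢)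
    (A : CongEis.SignReps N) (σ : CongEis.ScalingChoice 𝒢)
    (hodd : Odd k → -1 ∉ 𝒢 ∧ A.IsAdmissible 𝒢 ∧ σ.IsCompatible A) :
    (∀ x : CongEis.Cusp 𝒢, (Odd k → CongEis.IsRegularCusp x) → ∀ τ : UpperHalfPlane,
      CongEis.IsContinuation k (CongEis.seriesG k h A x τ) (CongEis.unnormG k h A x τ) ∧
      CongEis.IsContinuation k (CongEis.seriesE k 𝒢 (σ.mat x) τ) (CongEis.spectralE k σ x τ)) ∧
    ∀ x : CongEis.Cusp 𝒢, (Odd k → CongEis.IsRegularCusp x) →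
      ∀ (τ : UpperHalfPlane) (s : ℂ), 1 < ((k : ℂ) + 2 * s).re →
        CongEis.unnormG k h A x τ s =
          (CongEis.epsN N)⁻¹ * ∑ δ : (ZMod N)ˣ, CongEis.cuspSign h A σ x δ ^ k *
            CongEis.zetaPlus δ (k + 2 * s) *
              CongEis.spectralE k σ (CongEis.unitAct h δ⁻¹ x) τ s ∧
        CongEis.spectralE k σ x τ s =
          CongEis.epsN N * ∑ δ : (ZMod N)ˣ, CongEis.cuspSign h A σ x δ ^ k *
            CongEis.zetaPlusMu δ (k + 2 * s) *
              CongEis.unnormG k h A (CongEis.unitAct h δ⁻¹ x) τ s :=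
  ⟨fun x hx τ => ⟨CongEis.isContinuation_unnormG hk h A x τ,
      CongEis.isContinuation_spectralE hk h hodd hx τ⟩,
    fun x hx τ _ hs =>
      ⟨(CongEis.isContinuation_unnormG hk h A x τ).eqOn
          (CongEis.isContinuation_seriesG hk h hodd hx τ) hs,
        (CongEis.isContinuation_spectralE hk h hodd hx τ).eqOn
          (CongEis.isContinuation_seriesE hk h hodd hx τ) hs⟩⟩

theorem proposition5p1 (k : ℕ) (hk : 2 ≤ k) (N : ℕ) [NeZero N]
    (𝒢 : Subgroup (Matrix.SpecialLinearGroup (Fin 2) ℤ))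
    (h : CongruenceSubgroup.Gamma N ≤ 𝒢)
    (A : CongEis.SignReps N) (σ : CongEis.ScalingChoice 𝒢)
    (hodd : Odd k → -1 ∉ 𝒢 ∧ A.IsAdmissible 𝒢 ∧ σ.IsCompatible A) :
    (∀ x : CongEis.Cusp 𝒢, (Odd k → CongEis.IsRegularCusp x) → ∀ τ : UpperHalfPlane,
      CongEis.IsContinuation k (CongEis.seriesG k h A x τ) (CongEis.unnormG k h A x τ) ∧
      CongEis.IsContinuation k (CongEis.seriesE k 𝒢 (σ.mat x) τ) (CongEis.spectralE k σ x τ)) ∧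
    ∀ x : CongEis.Cusp 𝒢, (Odd k → CongEis.IsRegularCusp x) →
      ∀ (τ : UpperHalfPlane) (s : ℂ), 1 < ((k : ℂ) + 2 * s).re →
        CongEis.unnormG k h A x τ s =
          (CongEis.epsN N)⁻¹ * ∑ δ : (ZMod N)ˣ, CongEis.cuspSign h A σ x δ ^ k *
            CongEis.zetaPlus δ (k + 2 * s) *
              CongEis.spectralE k σ (CongEis.unitAct h δ⁻¹ x) τ s ∧
        CongEis.spectralE k σ x τ s =
          CongEis.epsN N * ∑ δ : (ZMod N)ˣ, CongEis.cuspSign h A σ x δ ^ k *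
            CongEis.zetaPlusMu δ (k + 2 * s) *
              CongEis.unnormG k h A (CongEis.unitAct h δ⁻¹ x) τ s :=
  proposition5p1_general k (by lia) N 𝒢 h A σ hodd
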